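/- A *logic* $\vdash$ is a substitution-invariant (not necessarily finitary) consequence relation on the formulas of an algebraic language $\mathscr{L}_\vdash$ (a set of finitary operation symbols of positive arity, constants being rendered as unary operations) over an infinite set of variables. It *has theorems* if $\emptyset\vdash\varphi$ for some formula $\varphi$. A *deductive filter* of $\vdash$ on a (non-empty) $\mathscr{L}_\vdash$-algebra $\mathbf A$ is a set $F\subseteq A$ such that $\Gamma\vdash\varphi$ and $h[\Gamma]\subseteq F$ imply $h(\varphi)\in F$, for every homomorphism $h$ from the formula algebra to $\mathbf A$. Let $\Omega^{\mathbf A}F$ be the largest congruence $\theta$ of $\mathbf A$ such that $F$ is a union of blocks of $\theta$, and let $\mathrm{Mod}^{\equiv}(\vdash)$ be the class of pairs $\langle\mathbf A,F\rangle$ such that $F$ is a deductive filter of $\vdash$ on $\mathbf A$ and $\bigcap\{\Omega^{\mathbf A}G : G\supseteq F \text{ a deductive filter of }\vdash\text{ on }\mathbf A\}$ is the identity relation. The logic $\vdash$ is *truth-equational* if there is a set $E(x)$ of equations in one variable such that, for all $\langle\mathbf A,F\rangle\in\mathrm{Mod}^{\equiv}(\vdash)$ and $a\in A$, $a\in F$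 if and only if $\mathbf A\vDash E(a)$. A *translation* $\tau$ of $\mathscr L$ into $\mathscr L'$ assigns to each $n$-ary symbol of $\mathscr L$ an $\mathscr L'$-term in the variables $x_1,\dots,x_n$; for an $\mathscr L'$-algebra $\mathbf A$, let $\mathbf A^{\tau}$ be the $\mathscr L$-algebra on $A$ whose operations are the term functions given by $\tau$. Write ${\vdash}\le{\vdash'}$ ($\vdash$ is *interpretable* in $\vdash'$) if there is a translation $\tau$ of $\mathscr L_\vdash$ into $\mathscr L_{\vdash'}$ such that $\langle\mathbf A,F\rangle\in\mathrm{Mod}^{\equiv}(\vdash')$ implies $\langle\mathbf A^{\tau},F\rangle\in\mathrm{Mod}^{\equiv}(\vdash)$. This is a preorder on logics; the associated partial order is $\mathsf{Log}$. A class of logics is a *Leibniz class* if it has the form $\{\vdash : {\vdash_\alpha}\le{\vdash}\text{ for some ordinal }\alpha\}$ for a family of logics $(\vdash_\alpha)$ indexed by all ordinals such that ${\vdash_\beta}\le{\vdash_\alpha}$ whenever $\alpha\le\beta$. **Theorem.** The class $\mathsf{Truth}$ of truth-equational logics is meet-prime among logics with theorems. That is, $\mathsf{Truth}$ is a Leibniz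 class comprising only logics with theorems, and for all Leibniz classes $\mathsf K_1,\mathsf K_2$ comprising only logics with theorems, if $\mathsf K_1\cap\mathsf K_2\subseteq\mathsf{Truth}$, then $\mathsf K_1\subseteq\mathsf{Truth}$ or $\mathsf K_2\subseteq\mathsf{Truth}$. Moreover, if $\vdash_1$ and $\vdash_2$ are logics with theorems that are not truth-equational, then there is a logic $\vdash$ that is not truth-equational and satisfies ${\vdash_1}\le{\vdash}$ and ${\vdash_2}\le{\vdash}$. -/

import Mathlib

universe u

namespace AAL

/-- A (propositional) logic: a substitution invariant consequence relation on the set of formulas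
of an algebraic language over an infinite set of variables.  Languages are sets of finitary function
symbols of positive arity (constants are rendered as unary operations), of arbitrary size. The
consequence relation need not be finitary. -/
structure Logic : Type (u + 1) where
  lang : FirstOrder.Language.{u, 0}
  algebraic : lang.IsAlgebraic
  no_constants : IsEmpty (lang.Functions 0)
  Var : Type u
  infinite_var : Infinite Var
  /-- `entails Γ φ` is `Γ ⊢ φ`. -/
  entails : Set (lang.Term Var) → lang.Term Var → Prop
  entails_of_mem : ∀ (Γ : Set (lang.Term Var)) (φ : lang.Term Var), φ ∈ Γ → entails Γ φ
  entails_cut : ∀ (Γ Δ : Set (lang.Term Var)) (φ : lang.Term Var),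
    (∀ δ ∈ Δ, entails Γ δ) → entails Δ φ → entails Γ φ
  entails_subst : ∀ (σ : Var → lang.Term Var) (Γ : Set (lang.Term Var)) (φ : lang.Term Var),
    entails Γ φ → entails ((fun γ => γ.subst σ) '' Γ) (φ.subst σ)

/-- An algebra in the language `L`: a non-empty set with an interpretation of the symbols. -/
structure Alg (L : FirstOrder.Language.{u, 0}) : Type (u + 1) where
  carrier : Type u
  nonempty : Nonempty carrier
  str : L.Structure carrier

/-- The value of a term `t` in the algebra `A` under the assignment `v`. Homomorphisms from a
term algebra into `A` are exactly the maps `t ↦ A.eval v t`. -/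
def Alg.eval {L : FirstOrder.Language.{u, 0}} (A : Alg.{u} L) {X : Type*} (v : X → A.carrier)
    (t : L.Term X) : A.carrier :=
  letI := A.str
  t.realize v

/-- The value of a basic operation of the algebra `A`. -/
def Alg.op {L : FirstOrder.Language.{u, 0}} (A : Alg.{u} L) {n : ℕ} (f : L.Functions n)
    (x : Fin n → A.carrier) : A.carrier :=
  A.str.funMap f x

/-- `θ` is a congruence of the algebra `A`. -/
def IsCongruence {L : FirstOrder.Language.{u, 0}} (A : Alg.{u} L) (θ : Setoid A.carrier) : Prop :=
  ∀ (n : ℕ) (f : L.Functions n) (x y : Fin n → A.carrier),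
    (∀ i, θ (x i) (y i)) → θ (A.op f x) (A.op f y)

/-- `θ` is compatible with `F`, i.e. `F` is a union of blocks of `θ`. -/
def IsCompatible {X : Type*} (θ : Setoid X) (F : Set X) : Prop :=
  ∀ a b, θ a b → a ∈ F → b ∈ F

/-- The Leibniz congruence of `F` on `A`: the largest congruence of `A` compatible with `F`, given
as the union of all congruences of `A` compatible with `F`. -/
def Leibniz {L : FirstOrder.Language.{u, 0}} (A : Alg.{u} L) (F : Set A.carrier) (a b : A.carrier) : Prop :=
  ∃ θ : Setoid A.carrier, IsCongruence A θ ∧ IsCompatible θ F ∧ θ a b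

namespace Logic

/-- `F` is a deductive filter of the logic on `A`, i.e. the matrix `⟨A, F⟩` is a model of it. -/
def IsFilter (l : Logic.{u}) (A : Alg.{u} l.lang) (F : Set A.carrier) : Prop :=
  ∀ (Γ : Set (l.lang.Term l.Var)) (φ : l.lang.Term l.Var), l.entails Γ φ →
    ∀ v : l.Var → A.carrier, (∀ γ ∈ Γ, A.eval v γ ∈ F) → A.eval v φ ∈ F

/-- The Suszko congruence of `F` on `A`: the intersection of the Leibniz congruences of all the
deductive filters of the logic on `A` that extend `F`. -/
def Suszko (l : Logic.{u}) (A : Alg.{u} l.lang) (F : Set A.carrier) (a b : A.carrier) : Prop :=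
  ∀ G : Set A.carrier, l.IsFilter A G → F ⊆ G → Leibniz A G a b

/-- `⟨A, F⟩ ∈ Mod^≡(⊢)`: a model whose Suszko congruence is the identity relation. -/
def IsReducedModel (l : Logic.{u}) (A : Alg.{u} l.lang) (F : Set A.carrier) : Prop :=
  l.IsFilter A F ∧ ∀ a b, l.Suszko A F a b → a = b

end Logic

/-- A translation assigns to every `n`-ary symbol of `L` an `L'`-term in the variables
`x_1, …, x_n`. -/
def Translation (L L' : FirstOrder.Language.{u, 0}) : Type u :=
  ∀ n : ℕ, L.Functions n → L'.Term (Fin n)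

/-- The `L`-algebra `A^τ`, with the universe of `A`, in which every symbol `f` is interpreted by
the term operation `τ(f)` of `A`. -/
def Translation.reduct {L L' : FirstOrder.Language.{u, 0}} (hL : L.IsAlgebraic) (τ : Translation L L')
    (A : Alg.{u} L') : Alg.{u} L where
  carrier := A.carrier
  nonempty := A.nonempty
  str :=
    { funMap := fun {n} f x => A.eval x (τ n f)
      RelMap := fun {n} r _ => ((hL n).false r).elim }

/-- `τ` is an interpretation of `l` into `l'`: `⟨A, F⟩ ∈ Mod^≡(l')` implies
`⟨A^τ, F⟩ ∈ Mod^≡(l)`. -/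
def IsInterpretation (l l' : Logic.{u}) (τ : Translation l.lang l'.lang) : Prop :=
  ∀ (A : Alg.{u} l'.lang) (F : Set A.carrier),
    l'.IsReducedModel A F → l.IsReducedModel (τ.reduct l.algebraic A) F

/-- `l ≤ l'` if `l` is interpretable into `l'`. This is the preorder whose associated partial
order is the poset of all logics. -/
instance Logic.instLE : LE Logic.{u} :=
  ⟨fun l l' => ∃ τ : Translation l.lang l'.lang, IsInterpretation l l' τ⟩

/-- A Leibniz condition: a decreasing family of logics indexed by all ordinals. -/
structure LeibnizCondition : Type (u + 1) where
  logic : Ordinal.{u} → Logic.{u}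
  decreasing : ∀ α β : Ordinal.{u}, α ≤ β → logic β ≤ logic α

/-- The class `Log(Φ)` of the logics that satisfy the Leibniz condition `Φ`. -/
def LeibnizCondition.models (Φ : LeibnizCondition.{u}) : Set Logic.{u} :=
  {l | ∃ α, Φ.logic α ≤ l}

/-- Leibniz classes. -/
def IsLeibnizClass (K : Set Logic.{u}) : Prop :=
  ∃ Φ : LeibnizCondition.{u}, K = Φ.models

/-- The logic has a theorem. -/
def Logic.HasTheorems (l : Logic.{u}) : Prop :=
  ∃ φ, l.entails ∅ φ

/-- The class of logics with theorems. -/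
def WithTheorems : Set Logic.{u} := {l | l.HasTheorems}

/-- The logic is truth-equational: there is a set `E(x)` of equations in the single variable `x`
that defines `F` in every `⟨A, F⟩ ∈ Mod^≡(⊢)`. -/
def Logic.IsTruthEquational (l : Logic.{u}) : Prop :=
  ∃ E : Set (l.lang.Term Unit × l.lang.Term Unit),
    ∀ (A : Alg.{u} l.lang) (F : Set A.carrier), l.IsReducedModel A F →
      ∀ a : A.carrier,
        a ∈ F ↔ ∀ e ∈ E, A.eval (fun _ => a) e.1 = A.eval (fun _ => a) e.2

/-- The class of truth-equational logics. -/
def TruthEquational : Set Logic.{u} := {l | l.IsTruthEquational}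

/-- `K` is a meet-prime element of the collection of the Leibniz classes that comprise only logics
with theorems, ordered by inclusion (meets are intersections). -/
def IsMeetPrimeAmongLogicsWithTheorems (K : Set Logic.{u}) : Prop :=
  IsLeibnizClass K ∧ K ⊆ WithTheorems ∧
    ∀ K₁ K₂ : Set Logic.{u}, IsLeibnizClass K₁ → IsLeibnizClass K₂ →
      K₁ ⊆ WithTheorems → K₂ ⊆ WithTheorems → K₁ ∩ K₂ ⊆ K → K₁ ⊆ K ∨ K₂ ⊆ K

end AAL

/-!
# Truth-equational logics are meet-prime among logics with theorems

**Upper bounds.** A logic that is not truth-equational does not even define truth implicitly in its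
reduced models: some algebra has two reduced filters `F ⊂ G` (`Logic.exists_two_reduced`). This is
seen in a generic reduced model, a quotient of the term algebra; if the logic fails to be
truth-equational, then the generator of the model can be omitted from the filter. The reduced models
are closed under subdirect products, and passing to a large power makes `F`, `G \ F` and the
complement of `G` equipotent to a prescribed power set (`Logic.exists_two_reduced_on`); here theorems
are needed to have `F` non-empty. Hence two such logics `l₁` and `l₂` have their pairs of reduced
filters on one and the same set `B`, and the pairs coincide. The required upper bound is the logic of
the two matrices `⟨B, F⟩` and `⟨B, G⟩`, where `B` carries all finitary operations. Both matrices are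
reduced, so truth is not definable. The operations include an equality test and, for each filter `K`
of `l₁` above `F`, an implication whose sections define filters of `l₁` in every model. The logic of
the two matrices has a rule which says that elements indistinguishable by the unary polynomials of
`l₁` and by these filters pass the equality test. It follows that reduced models have reduced
`l₁`-reducts (`le_pairLogic`), and the same holds for `l₂`.

**The Leibniz class.** Truth-equationality is preserved upwards under interpretability. A family of
truth-equational logics indexed by a small type has a truth-equational lower bound, the logic of all
their models as algebras of a language whose symbols are families of terms
(`exists_truthEquational_le`). Its defining equations are those of the individual logics; that they
suffice relies on symbols that are the second projection in one member of the family and the first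
one in the others, whose sections turn filters of the combined logic into filters of the members.
Up to lower bounds, the truth-equational logics of bounded size form a small family
(`exists_uniform_le`), so transfinite recursion gives a decreasing sequence of truth-equational
logics such that each truth-equational logic lies above one of them.
-/

namespace AAL

variable {L L' : FirstOrder.Language.{u, 0}}

/-! ### Evaluation, homomorphisms and translations -/

namespace Alg

theorem eval_var (A : Alg.{u} L) {X : Type*} (v : X → A.carrier) (x : X) :
    A.eval v (.var x) = v x := rfl

theorem eval_func (A : Alg.{u} L) {X : Type*} (v : X → A.carrier) {n : ℕ} (f : L.Functions n)
    (ts : Fin n → L.Term X) : A.eval v (.func f ts) = A.op f fun i => A.eval v (ts i) := rfl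

theorem eval_relabel (A : Alg.{u} L) {X Y : Type*} (g : X → Y) (v : Y → A.carrier)
    (t : L.Term X) : A.eval v (t.relabel g) = A.eval (fun x => v (g x)) t :=
  letI := A.str
  FirstOrder.Language.Term.realize_relabel

theorem eval_subst (A : Alg.{u} L) {X Y : Type*} (σ : X → L.Term Y) (v : Y → A.carrier)
    (t : L.Term X) : A.eval v (t.subst σ) = A.eval (fun x => A.eval v (σ x)) t :=
  letI := A.str
  FirstOrder.Language.Term.realize_subst

end Alg

theorem IsCongruence.eval {A : Alg.{u} L} {θ : Setoid A.carrier} (hθ : IsCongruence A θ)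
    {X : Type*} {v w : X → A.carrier} (h : ∀ x, θ (v x) (w x)) (t : L.Term X) :
    θ (A.eval v t) (A.eval w t) := by
  induction t with
  | var x => exact h x
  | func f ts ih => exact hθ _ f _ _ ih

/-- `h` is a homomorphism of algebras. -/
def IsHom (A B : Alg.{u} L) (h : A.carrier → B.carrier) : Prop :=
  ∀ (n : ℕ) (f : L.Functions n) (x : Fin n → A.carrier), h (A.op f x) = B.op f fun i => h (x i)

theorem IsHom.eval {A B : Alg.{u} L} {h : A.carrier → B.carrier} (hh : IsHom A B h)
    {X : Type*} (v : X → A.carrier) (t : L.Term X) :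
    h (A.eval v t) = B.eval (fun x => h (v x)) t := by
  induction t with
  | var x => rfl
  | func f ts ih => rw [Alg.eval_func, hh, Alg.eval_func]; simp only [ih]

/-- The extension of a translation from basic symbols to all terms. -/
def Translation.onTerm (τ : Translation L L') {X : Type*} : L.Term X → L'.Term X
  | .var x => .var x
  | .func f ts => (τ _ f).subst fun i => τ.onTerm (ts i)

theorem Translation.eval_onTerm (hL : L.IsAlgebraic) (τ : Translation L L') (A : Alg.{u} L')
    {X : Type*} (v : X → A.carrier) (t : L.Term X) :
    A.eval v (τ.onTerm t) = (τ.reduct hL A).eval v t := by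
  induction t with
  | var x => rfl
  | func f ts ih =>
    exact (A.eval_subst _ v (τ _ f)).trans (congrArg (fun w => A.eval w (τ _ f)) (funext ih))

/-- Congruences of an algebra are congruences of all its reducts along translations. -/
theorem IsCongruence.reduct (hL : L.IsAlgebraic) (τ : Translation L L') {A : Alg.{u} L'}
    {θ : Setoid A.carrier} (hθ : IsCongruence A θ) : IsCongruence (τ.reduct hL A) θ :=
  fun _ f _ _ h => hθ.eval h (τ _ f)

theorem Leibniz.reduct (hL : L.IsAlgebraic) (τ : Translation L L') {A : Alg.{u} L'}
    {F : Set A.carrier} {a b : A.carrier} (h : Leibniz A F a b) :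
    Leibniz (τ.reduct hL A) F a b :=
  let ⟨θ, hθ, hF, hab⟩ := h
  ⟨θ, hθ.reduct hL τ, hF, hab⟩

/-! ### The Leibniz and Suszko congruences -/

/-- Two elements indistinguishable by unary polynomials of `A` with respect to membership in `F`.
A unary polynomial is given by a term in the variables `Option ℕ`, where `none` is its argument,
and by the values of the remaining variables. -/
def PolyEquiv (A : Alg.{u} L) (F : Set A.carrier) (a b : A.carrier) : Prop :=
  ∀ (t : L.Term (Option ℕ)) (v : ℕ → A.carrier),
    A.eval (fun o => o.elim a v) t ∈ F ↔ A.eval (fun o => o.elim b v) t ∈ F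

theorem PolyEquiv.update {A : Alg.{u} L} {F : Set A.carrier} {a b : A.carrier}
    (h : PolyEquiv A F a b) {n : ℕ} (f : L.Functions n) (x : Fin n → A.carrier) (k : Fin n) :
    PolyEquiv A F (A.op f (Function.update x k a)) (A.op f (Function.update x k b)) := by
  intro t v
  -- The variables below `n` of the new polynomial hold the arguments of `f`, the others those
  -- of `t`.
  let t' : L.Term (Option ℕ) := t.subst fun o =>
    o.elim (.func f fun i => .var (if i = k then none else some i.1))
      fun m => .var (some (n + m))
  let v' : ℕ → A.carrier := fun m => if hm : m < n then x ⟨m, hm⟩ else v (m - n)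
  have key : ∀ c, A.eval (fun o => o.elim c v') t' =
      A.eval (fun o => o.elim (A.op f (Function.update x k c)) v) t := by
    intro c
    rw [Alg.eval_subst]
    congr 1
    funext o
    cases o with
    | none =>
      simp only [Option.elim_none, Alg.eval_func, Alg.eval_var]
      congr 1
      funext i
      by_cases hi : i = k
      · subst hi; simp
      · simp [hi, v']
    | some m => simp [Alg.eval_var, v']
  rw [← key, ← key]
  exact h t' v'

/-- Indistinguishability by unary polynomials, as an equivalence relation. -/
def polySetoid (A : Alg.{u} L) (F : Set A.carrier) : Setoid A.carrier where
  r := PolyEquiv A F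
  iseqv := ⟨fun _ _ _ => Iff.rfl, fun h t v => (h t v).symm,
    fun h h' t v => (h t v).trans (h' t v)⟩

theorem isCongruence_polySetoid (A : Alg.{u} L) (F : Set A.carrier) :
    IsCongruence A (polySetoid A F) := by
  intro n f x y hxy
  -- Replace the arguments `x i` by `y i` one after the other.
  have key : ∀ k ≤ n, polySetoid A F (A.op f x) (A.op f fun i => if i.1 < k then y i else x i) := by
    intro k
    induction k with
    | zero => intro _; simp
    | succ k ih =>
      intro hk
      refine (polySetoid A F).trans (ih (by omega)) ?_
      have h := PolyEquiv.update (hxy ⟨k, hk⟩) f (fun i => if i.1 < k then y i else x i) ⟨k, hk⟩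
      have hx : Function.update (fun i => if i.1 < k then y i else x i) ⟨k, hk⟩ (x ⟨k, hk⟩) =
          fun i => if i.1 < k then y i else x i := by simp
      have hy : Function.update (fun i => if i.1 < k then y i else x i) ⟨k, hk⟩ (y ⟨k, hk⟩) =
          fun i => if i.1 < k + 1 then y i else x i := by
        funext i
        by_cases hi : i = ⟨k, hk⟩
        · subst hi; simp
        · have : i.1 ≠ k := fun h => hi (Fin.ext h)
          have : i.1 < k + 1 ↔ i.1 < k := by omega
          simp [hi, this]
      rw [hx, hy] at h
      exact h
  simpa using key n le_rfl

theorem isCompatible_polySetoid (A : Alg.{u} L) (F : Set A.carrier) :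
    IsCompatible (polySetoid A F) F :=
  fun a _ h ha => (h (.var none) fun _ => a).1 ha

theorem leibniz_iff {A : Alg.{u} L} {F : Set A.carrier} {a b : A.carrier} :
    Leibniz A F a b ↔ PolyEquiv A F a b := by
  constructor
  · rintro ⟨θ, hθ, hF, hab⟩ t v
    have h : θ (A.eval (fun o => o.elim a v) t) (A.eval (fun o => o.elim b v) t) :=
      hθ.eval (fun o => by cases o; exacts [hab, θ.refl _]) t
    exact ⟨hF _ _ h, hF _ _ (θ.symm h)⟩
  · exact fun h => ⟨_, isCongruence_polySetoid A F, isCompatible_polySetoid A F, h⟩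

theorem Leibniz.refl (A : Alg.{u} L) (F : Set A.carrier) (a : A.carrier) : Leibniz A F a a :=
  leibniz_iff.2 fun _ _ => Iff.rfl

theorem Leibniz.mem {A : Alg.{u} L} {F : Set A.carrier} {a b : A.carrier}
    (h : Leibniz A F a b) (ha : a ∈ F) : b ∈ F :=
  let ⟨_, _, hF, hab⟩ := h
  hF _ _ hab ha

theorem Leibniz.comap {A B : Alg.{u} L} {h : A.carrier → B.carrier} (hh : IsHom A B h)
    {F : Set B.carrier} {a b : A.carrier} (hab : Leibniz B F (h a) (h b)) :
    Leibniz A (h ⁻¹' F) a b := by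
  rw [leibniz_iff] at hab ⊢
  intro t v
  have key : ∀ c, h (A.eval (fun o => o.elim c v) t) =
      B.eval (fun o => o.elim (h c) fun m => h (v m)) t := by
    intro c
    rw [hh.eval]
    congr 1
    funext o
    cases o <;> rfl
  simpa only [Set.mem_preimage, key] using hab t fun m => h (v m)

theorem Leibniz.of_comap {A B : Alg.{u} L} {h : A.carrier → B.carrier} (hh : IsHom A B h)
    (hs : Function.Surjective h) {F : Set B.carrier} {a b : A.carrier}
    (hab : Leibniz A (h ⁻¹' F) a b) : Leibniz B F (h a) (h b) := by
  rw [leibniz_iff] at hab ⊢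
  intro t v
  choose g hg using hs
  have key : ∀ c, h (A.eval (fun o => o.elim c fun m => g (v m)) t) =
      B.eval (fun o => o.elim (h c) v) t := by
    intro c
    rw [hh.eval]
    congr 1
    funext o
    cases o
    · rfl
    · exact hg _
  simpa only [Set.mem_preimage, key] using hab t fun m => g (v m)

namespace Logic

variable {l : Logic.{u}}

/-- The Suszko congruence as an equivalence relation. -/
def suszkoSetoid (l : Logic.{u}) (A : Alg.{u} l.lang) (F : Set A.carrier) : Setoid A.carrier where
  r := l.Suszko A F
  iseqv :=
    ⟨fun a G _ _ => Leibniz.refl A G a,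
      fun h G hG hF => leibniz_iff.2 ((polySetoid A G).symm (leibniz_iff.1 (h G hG hF))),
      fun h h' G hG hF => leibniz_iff.2
        ((polySetoid A G).trans (leibniz_iff.1 (h G hG hF)) (leibniz_iff.1 (h' G hG hF)))⟩

theorem isCongruence_suszkoSetoid (A : Alg.{u} l.lang) (F : Set A.carrier) :
    IsCongruence A (l.suszkoSetoid A F) :=
  fun n f x y h G hG hF => leibniz_iff.2
    (isCongruence_polySetoid A G n f x y fun i => leibniz_iff.1 (h i G hG hF))

theorem IsFilter.comap {A B : Alg.{u} l.lang} {h : A.carrier → B.carrier} (hh : IsHom A B h)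
    {F : Set B.carrier} (hF : l.IsFilter B F) : l.IsFilter A (h ⁻¹' F) := by
  intro Γ φ hΓ v hv
  simp only [Set.mem_preimage, hh.eval] at hv ⊢
  exact hF Γ φ hΓ _ hv

theorem IsFilter.of_comap {A B : Alg.{u} l.lang} {h : A.carrier → B.carrier} (hh : IsHom A B h)
    (hs : Function.Surjective h) {F : Set B.carrier} (hF : l.IsFilter A (h ⁻¹' F)) :
    l.IsFilter B F := by
  intro Γ φ hΓ v hv
  choose g hg using hs
  have key : ∀ t, h (A.eval (fun x => g (v x)) t) = B.eval v t := fun t => by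
    rw [hh.eval]; simp only [hg]
  simpa only [Set.mem_preimage, key] using hF Γ φ hΓ (fun x => g (v x)) fun γ hγ => by
    simpa only [Set.mem_preimage, key] using hv γ hγ

theorem IsFilter.iInter {A : Alg.{u} l.lang} {ι : Sort*} {F : ι → Set A.carrier}
    (hF : ∀ i, l.IsFilter A (F i)) : l.IsFilter A (⋂ i, F i) := fun Γ φ hΓ v hv =>
  Set.mem_iInter.2 fun i => hF i Γ φ hΓ v fun γ hγ => Set.mem_iInter.1 (hv γ hγ) i

theorem IsFilter.inter {A : Alg.{u} l.lang} {F G : Set A.carrier}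
    (hF : l.IsFilter A F) (hG : l.IsFilter A G) : l.IsFilter A (F ∩ G) := fun Γ φ hΓ v hv =>
  ⟨hF Γ φ hΓ v fun γ hγ => (hv γ hγ).1, hG Γ φ hΓ v fun γ hγ => (hv γ hγ).2⟩

/-- The Suszko congruence is monotone in the filter, so a filter below a reduced one is reduced. -/
theorem IsReducedModel.anti {A : Alg.{u} l.lang} {F G : Set A.carrier}
    (hG : l.IsReducedModel A G) (hF : l.IsFilter A F) (h : F ⊆ G) : l.IsReducedModel A F :=
  ⟨hF, fun a b hab => hG.2 a b fun K hK hGK => hab K hK (h.trans hGK)⟩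

/-- Subdirect products of reduced models are reduced. -/
theorem isReducedModel_of_subdirect {A : Alg.{u} l.lang} {ι : Type*} (B : ι → Alg.{u} l.lang)
    (F : ∀ i, Set (B i).carrier) (hB : ∀ i, l.IsReducedModel (B i) (F i))
    (h : ∀ i, A.carrier → (B i).carrier) (hh : ∀ i, IsHom A (B i) (h i))
    (hs : ∀ i, Function.Surjective (h i)) (hinj : ∀ a b, (∀ i, h i a = h i b) → a = b) :
    l.IsReducedModel A (⋂ i, h i ⁻¹' F i) :=
  ⟨IsFilter.iInter fun i => (hB i).1.comap (hh i), fun a b hab => hinj a b fun i =>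
    (hB i).2 _ _ fun _ hG hFG => (hab _ (hG.comap (hh i))
      ((Set.iInter_subset _ i).trans (Set.preimage_mono hFG))).of_comap (hh i) (hs i)⟩

end Logic

/-! ### Quotients -/

/-- The quotient of an algebra by a congruence. -/
noncomputable abbrev Alg.quot (A : Alg.{u} L) (hL : L.IsAlgebraic) (θ : Setoid A.carrier) :
    Alg.{u} L where
  carrier := Quotient θ
  nonempty := A.nonempty.map (Quotient.mk θ)
  str :=
    { funMap := fun f x => Quotient.mk θ (A.op f fun i => (x i).out)
      RelMap := fun {n} r _ => ((hL n).false r).elim }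

theorem Alg.isHom_quot (A : Alg.{u} L) (hL : L.IsAlgebraic) {θ : Setoid A.carrier}
    (hθ : IsCongruence A θ) : IsHom A (A.quot hL θ) (Quotient.mk θ) := fun n f x =>
  Quotient.sound (hθ n f _ _ fun i => θ.symm (Quotient.mk_out (x i)))

/-- The image of `F` in the quotient by `θ`, provided that `θ` is compatible with `F`. -/
def quotSet {X : Type*} (θ : Setoid X) (F : Set X) : Set (Quotient θ) :=
  {q | ∀ a, Quotient.mk θ a = q → a ∈ F}

theorem preimage_quotSet {X : Type*} {θ : Setoid X} {F : Set X} (h : IsCompatible θ F) :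
    Quotient.mk θ ⁻¹' quotSet θ F = F :=
  Set.ext fun a => ⟨fun ha => ha a rfl, fun ha _ hb => h _ _ (θ.symm (Quotient.exact hb)) ha⟩

namespace Logic

variable {l : Logic.{u}}

theorem IsFilter.quot {A : Alg.{u} l.lang} {θ : Setoid A.carrier} (hθ : IsCongruence A θ)
    {F : Set A.carrier} (hF : l.IsFilter A F) (h : IsCompatible θ F) :
    l.IsFilter (A.quot l.algebraic θ) (quotSet θ F) :=
  IsFilter.of_comap (A.isHom_quot l.algebraic hθ) Quotient.mk_surjective
    (by rw [preimage_quotSet h]; exact hF)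

/-- A quotient is reduced if the filters compatible with the congruence separate its blocks. -/
theorem isReducedModel_quot {A : Alg.{u} l.lang} {θ : Setoid A.carrier} (hθ : IsCongruence A θ)
    {F : Set A.carrier} (hF : l.IsFilter A F) (h : IsCompatible θ F)
    (hsep : ∀ a b, ¬ θ a b →
      ∃ G, l.IsFilter A G ∧ F ⊆ G ∧ IsCompatible θ G ∧ ¬ Leibniz A G a b) :
    l.IsReducedModel (A.quot l.algebraic θ) (quotSet θ F) := by
  refine ⟨hF.quot hθ h, fun p q hpq => ?_⟩
  obtain ⟨a, rfl⟩ := Quotient.mk_surjective p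
  obtain ⟨b, rfl⟩ := Quotient.mk_surjective q
  by_contra hne
  obtain ⟨G, hG, hFG, hGc, hab⟩ := hsep a b fun h => hne (Quotient.sound h)
  have := (hpq _ (hG.quot hθ hGc) fun x hx a ha => hFG (hx a ha)).comap
    (A.isHom_quot l.algebraic hθ)
  rw [preimage_quotSet hGc] at this
  exact hab this

theorem isReducedModel_quot_suszko {A : Alg.{u} l.lang} {F : Set A.carrier}
    (hF : l.IsFilter A F) :
    l.IsReducedModel (A.quot l.algebraic (l.suszkoSetoid A F))
      (quotSet (l.suszkoSetoid A F) F) := by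
  have hc : ∀ G, l.IsFilter A G → F ⊆ G → IsCompatible (l.suszkoSetoid A F) G :=
    fun G hG hFG a b hab ha => (hab G hG hFG).mem ha
  refine isReducedModel_quot (isCongruence_suszkoSetoid A F) hF (hc F hF subset_rfl) ?_
  intro a b hab
  by_contra! hcon
  exact hab fun G hG hFG => hcon G hG hFG (hc G hG hFG)

/-- The set `E` of equations defines the filters of all reduced models of `l`. -/
def DefinesTruth (l : Logic.{u}) (E : Set (l.lang.Term Unit × l.lang.Term Unit)) : Prop :=
  ∀ (A : Alg.{u} l.lang) (F : Set A.carrier), l.IsReducedModel A F → ∀ a : A.carrier,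
    a ∈ F ↔ ∀ e ∈ E, A.eval (fun _ => a) e.1 = A.eval (fun _ => a) e.2

/-- In arbitrary models, equality in the defining equations becomes the Suszko congruence. -/
theorem DefinesTruth.mem_iff {E : Set (l.lang.Term Unit × l.lang.Term Unit)}
    (hE : l.DefinesTruth E) {A : Alg.{u} l.lang} {F : Set A.carrier} (hF : l.IsFilter A F)
    (a : A.carrier) :
    a ∈ F ↔ ∀ e ∈ E, l.Suszko A F (A.eval (fun _ => a) e.1) (A.eval (fun _ => a) e.2) := by
  let θ := l.suszkoSetoid A F
  have hθ : IsCongruence A θ := isCongruence_suszkoSetoid A F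
  have hc : IsCompatible θ F := fun a b hab ha => (hab F hF subset_rfl).mem ha
  have h1 : a ∈ F ↔ Quotient.mk θ a ∈ quotSet θ F := by
    conv_lhs => rw [← preimage_quotSet hc]
    rfl
  rw [h1, hE _ _ (isReducedModel_quot_suszko hF)]
  refine forall₂_congr fun e _ => ?_
  have hev : ∀ t : l.lang.Term Unit,
      (A.quot l.algebraic θ).eval (fun _ => Quotient.mk θ a) t =
        Quotient.mk θ (A.eval (fun _ => a) t) :=
    fun t => ((A.isHom_quot l.algebraic hθ).eval (fun _ => a) t).symm
  exact (by rw [hev, hev] : _ ↔ _).trans (Quotient.eq (r := θ))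

end Logic

/-! ### The interpretability preorder -/

namespace Logic

/-- Reducedness is invariant under isomorphism. -/
theorem IsReducedModel.of_bijective {l : Logic.{u}} {A B : Alg.{u} l.lang}
    {h : A.carrier → B.carrier} (hh : IsHom A B h) (hb : Function.Bijective h)
    {F : Set B.carrier} (hF : l.IsReducedModel B F) : l.IsReducedModel A (h ⁻¹' F) := by
  have := isReducedModel_of_subdirect (fun _ : Unit => B) (fun _ => F) (fun _ => hF)
    (fun _ => h) (fun _ => hh) (fun _ => hb.2) fun a b hab => hb.1 (hab ())
  rwa [Set.iInter_const] at this

theorem le_refl (l : Logic.{u}) : l ≤ l :=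
  ⟨fun _ f => .func f .var, fun A F h =>
    IsReducedModel.of_bijective (A := Translation.reduct l.algebraic (fun _ f => .func f .var) A)
      (B := A) (F := F) (h := id) (fun _ _ _ => rfl) Function.bijective_id h⟩

theorem le_trans {l₁ l₂ l₃ : Logic.{u}} : l₁ ≤ l₂ → l₂ ≤ l₃ → l₁ ≤ l₃ := by
  rintro ⟨τ, hτ⟩ ⟨ρ, hρ⟩
  let χ : Translation l₁.lang l₃.lang := fun n f => ρ.onTerm (τ n f)
  refine ⟨χ, fun A F h =>
    IsReducedModel.of_bijective (A := χ.reduct l₁.algebraic A)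
      (B := τ.reduct l₁.algebraic (ρ.reduct l₂.algebraic A)) (F := F)
      (h := id) (fun n f x => ?_)
      Function.bijective_id (hτ _ _ (hρ A F h))⟩
  exact ρ.eval_onTerm l₂.algebraic A x (τ n f)

theorem IsTruthEquational.of_le {l l' : Logic.{u}} (h : l.IsTruthEquational) (hl : l ≤ l') :
    l'.IsTruthEquational := by
  obtain ⟨E, hE⟩ := h
  obtain ⟨τ, hτ⟩ := hl
  refine ⟨(fun e => (τ.onTerm e.1, τ.onTerm e.2)) '' E, fun A F hF a => ?_⟩
  rw [Set.forall_mem_image]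
  simp only [τ.eval_onTerm l.algebraic]
  exact hE (τ.reduct l.algebraic A) F (hτ A F hF) a

/-- Without theorems the empty set is a filter of the one-element algebra, which then carries two
reduced models; no set of equations distinguishes them. -/
theorem IsTruthEquational.hasTheorems {l : Logic.{u}} (h : l.IsTruthEquational) :
    l.HasTheorems := by
  by_contra hno
  obtain ⟨E, hE⟩ := h
  let A : Alg.{u} l.lang := ⟨PUnit, ⟨⟨⟩⟩,
    { funMap := fun _ _ => ⟨⟩
      RelMap := fun {n} r _ => ((l.algebraic n).false r).elim }⟩
  have hF : l.IsReducedModel A ∅ := by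
    refine ⟨fun Γ φ hΓ v hv => hno ⟨φ, ?_⟩, fun _ _ _ => rfl⟩
    rwa [← Set.eq_empty_iff_forall_notMem.2 hv]
  exact (hE A ∅ hF ⟨⟩).2 fun _ _ => rfl

end Logic

/-! ### Failure of implicit definability -/

/-- The algebra of terms in countably many variables. -/
abbrev termAlg (hL : L.IsAlgebraic) : Alg.{u} L where
  carrier := L.Term ℕ
  nonempty := ⟨.var 0⟩
  str :=
    { funMap := fun f ts => .func f ts
      RelMap := fun {n} r _ => ((hL n).false r).elim }

theorem isHom_eval (hL : L.IsAlgebraic) (A : Alg.{u} L) (v : ℕ → A.carrier) :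
    IsHom (termAlg hL) A (A.eval v) := fun _ _ _ => rfl

theorem exists_eval_congr (t : L.Term ℕ) : ∃ N, ∀ (A : Alg.{u} L) (v w : ℕ → A.carrier),
    (∀ i < N, v i = w i) → A.eval v t = A.eval w t := by
  induction t with
  | var x => exact ⟨x + 1, fun A v w h => h x (Nat.lt_succ_self x)⟩
  | func f ts ih =>
    choose N hN using ih
    refine ⟨Finset.univ.sup N, fun A v w h => ?_⟩
    rw [Alg.eval_func, Alg.eval_func]
    congr 1
    funext i
    exact hN i A v w fun j hj => h j (hj.trans_le (Finset.le_sup (Finset.mem_univ i)))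

namespace Logic

variable {l : Logic.{u}}

/-- Two terms are related if they take the same value in every reduced model under every assignment
that sends the variable `0` into the filter. -/
def genericSetoid (l : Logic.{u}) : Setoid (l.lang.Term ℕ) where
  r s t := ∀ (A : Alg.{u} l.lang) (F : Set A.carrier), l.IsReducedModel A F →
    ∀ v : ℕ → A.carrier, v 0 ∈ F → A.eval v s = A.eval v t
  iseqv := ⟨fun _ _ _ _ _ _ => rfl, fun h A F hF v hv => (h A F hF v hv).symm,
    fun h h' A F hF v hv => (h A F hF v hv).trans (h' A F hF v hv)⟩

theorem isCongruence_genericSetoid (l : Logic.{u}) :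
    IsCongruence (termAlg l.algebraic) l.genericSetoid := fun _ f _ _ h A F hF v hv =>
  congrArg (A.op f) (funext fun i => h i A F hF v hv)

/-- The terms that are true in every reduced model under every assignment that makes the variable
`0` true. -/
def genericFilter (l : Logic.{u}) : Set (l.lang.Term ℕ) :=
  {t | ∀ (A : Alg.{u} l.lang) (F : Set A.carrier), l.IsReducedModel A F →
    ∀ v : ℕ → A.carrier, v 0 ∈ F → A.eval v t ∈ F}

theorem isFilter_genericFilter (l : Logic.{u}) :
    l.IsFilter (termAlg l.algebraic) l.genericFilter := fun Γ φ hΓ w hw A F hF v hv =>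
  (hF.1.comap (isHom_eval l.algebraic A v)) Γ φ hΓ w fun γ hγ => hw γ hγ A F hF v hv

theorem isCompatible_genericSetoid (A : Alg.{u} l.lang) (F G : Set A.carrier)
    (hF : l.IsReducedModel A F) (v : ℕ → A.carrier) (hv : v 0 ∈ F) :
    IsCompatible l.genericSetoid (A.eval v ⁻¹' G) := fun s t hst hs => by
  rwa [Set.mem_preimage, ← hst A F hF v hv]

theorem isReducedModel_generic (l : Logic.{u}) :
    l.IsReducedModel ((termAlg l.algebraic).quot l.algebraic l.genericSetoid)
      (quotSet l.genericSetoid l.genericFilter) := by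
  refine isReducedModel_quot l.isCongruence_genericSetoid l.isFilter_genericFilter
    (fun s t hst hs A F hF v hv => hst A F hF v hv ▸ hs A F hF v hv) fun s t hst => ?_
  -- Some reduced model separates `s` and `t`, hence so does one of its polynomials.  The parameters
  -- of the polynomial become values of variables that do not occur in `s` and `t`.
  have hst' : ∃ (A : Alg.{u} l.lang) (F : Set A.carrier), l.IsReducedModel A F ∧
      ∃ v : ℕ → A.carrier, v 0 ∈ F ∧ A.eval v s ≠ A.eval v t := by
    by_contra! hcon
    exact hst hcon
  obtain ⟨A, F, hF, v, hv, hne⟩ := hst'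
  have hsus : ∃ G, l.IsFilter A G ∧ F ⊆ G ∧ ¬ Leibniz A G (A.eval v s) (A.eval v t) := by
    by_contra! hcon
    exact hne (hF.2 _ _ hcon)
  obtain ⟨G, hG, hFG, hL⟩ := hsus
  have hpoly : ∃ (q : l.lang.Term (Option ℕ)) (w : ℕ → A.carrier),
      ¬ (A.eval (fun o => o.elim (A.eval v s) w) q ∈ G ↔
        A.eval (fun o => o.elim (A.eval v t) w) q ∈ G) := by
    by_contra! hcon
    exact hL (leibniz_iff.2 hcon)
  obtain ⟨q, w, hq⟩ := hpoly
  obtain ⟨M, hM⟩ := exists_eval_congr s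
  obtain ⟨N, hN⟩ := exists_eval_congr t
  let K := M + N + 1
  let v' : ℕ → A.carrier := fun i => if i < K then v i else w (i - K)
  have hs : A.eval v' s = A.eval v s :=
    hM A _ _ fun i hi => if_pos (show i < K by omega)
  have ht : A.eval v' t = A.eval v t :=
    hN A _ _ fun i hi => if_pos (show i < K by omega)
  have hv' : v' 0 ∈ F := by
    have : v' 0 = v 0 := if_pos (Nat.succ_pos _)
    rwa [this]
  refine ⟨A.eval v' ⁻¹' G, hG.comap (isHom_eval l.algebraic A v'),
    fun r hr => hFG (hr A F hF v' hv'), isCompatible_genericSetoid A F G hF v' hv', fun h => hq ?_⟩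
  have key : ∀ r, A.eval v' ((termAlg l.algebraic).eval
      (fun o => o.elim r fun m => .var (K + m)) q) =
      A.eval (fun o => o.elim (A.eval v' r) w) q := by
    intro r
    rw [(isHom_eval l.algebraic A v').eval]
    congr 1
    funext o
    cases o <;> simp [Alg.eval_var, v']
  have := leibniz_iff.1 h q fun m => .var (K + m)
  simpa only [Set.mem_preimage, key, hs, ht] using this

/-- In a logic that is not truth-equational, truth is not even implicitly definable. Otherwise the
equations that hold for all true elements of reduced models would define truth: an element `a` of
`⟨A, F⟩` which satisfies them induces a homomorphism from the generic reduced model that sends the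
generator to `a`. If `a ∉ F`, then the preimage of `F` is a filter that omits the generator, and its
intersection with the generic filter is a second, smaller reduced filter. -/
theorem exists_two_reduced (h : ¬ l.IsTruthEquational) :
    ∃ (A : Alg.{u} l.lang) (F G : Set A.carrier), l.IsReducedModel A F ∧ l.IsReducedModel A G ∧
      F ⊆ G ∧ ∃ a ∈ G, a ∉ F := by
  by_contra hcon
  refine h ⟨{e | ∀ (A : Alg.{u} l.lang) (F : Set A.carrier), l.IsReducedModel A F → ∀ a ∈ F,
    A.eval (fun _ => a) e.1 = A.eval (fun _ => a) e.2}, fun A F hF a => ⟨fun ha e he =>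
      he A F hF a ha, fun ha => ?_⟩⟩
  by_contra haF
  apply hcon
  let T₀ : Set (l.lang.Term ℕ) := A.eval (fun _ => a) ⁻¹' F
  have hT₀ : l.IsFilter (termAlg l.algebraic) T₀ := hF.1.comap (isHom_eval l.algebraic A _)
  have hc₀ : IsCompatible l.genericSetoid T₀ := by
    intro s t hst hs
    have := ha (s.relabel fun _ => (), t.relabel fun _ => ()) fun B G hG b hb => by
      simpa only [Alg.eval_relabel] using hst B G hG (fun _ => b) hb
    simp only [Alg.eval_relabel] at this
    change A.eval _ t ∈ F
    rw [← this]
    exact hs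
  have hred := l.isReducedModel_generic
  let H := quotSet l.genericSetoid l.genericFilter ∩ quotSet l.genericSetoid T₀
  have hH : l.IsFilter ((termAlg l.algebraic).quot l.algebraic l.genericSetoid) H :=
    hred.1.inter (hT₀.quot l.isCongruence_genericSetoid hc₀)
  refine ⟨_, H, _, hred.anti hH Set.inter_subset_left, hred, Set.inter_subset_left,
    Quotient.mk _ (.var 0), ?_, fun hmem => haF (hmem.2 (.var 0) rfl)⟩
  intro s hs B G hG v hv
  rw [Quotient.exact hs B G hG v hv]
  exact hv

theorem HasTheorems.exists_mem (hl : l.HasTheorems) {A : Alg.{u} l.lang} {F : Set A.carrier}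
    (hF : l.IsFilter A F) : ∃ a, a ∈ F :=
  let ⟨φ, hφ⟩ := hl
  let ⟨a⟩ := A.nonempty
  ⟨_, hF ∅ φ hφ (fun _ => a) fun _ hγ => hγ.elim⟩

/-- The filter of a reduced model with at least two elements is proper. -/
theorem IsReducedModel.exists_notMem {A : Alg.{u} l.lang} {F : Set A.carrier}
    (hF : l.IsReducedModel A F) {a b : A.carrier} (hab : a ≠ b) : ∃ c, c ∉ F := by
  by_contra! hall
  refine hab (hF.2 a b fun G _ hFG => leibniz_iff.2 fun t v => ?_)
  exact iff_of_true (hFG (hall _)) (hFG (hall _))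

/-! ### Reduced models on a prescribed set -/

open Cardinal in
/-- For a logic with theorems that is not truth-equational, two reduced filters can be found on an
algebra whose universe, and the position of the two filters in it, depend only on a large enough
set `κ`.  The algebra is a power of an algebra with reduced filters `F ⊂ G`; the smaller of the two filters
consists of the families with one prescribed coordinate in `F` and the others in `G`.  Each of the
three pieces that the two filters cut out has the cardinality of `κ → Bool`. -/
theorem exists_two_reduced_on (hl : l.HasTheorems) (h : ¬ l.IsTruthEquational) :
    ∃ X : Type u, ∀ κ : Type u, Infinite κ → #X ≤ #κ →
      ∃ (ne : Nonempty (Fin 3 × (κ → Bool))) (S : l.lang.Structure (Fin 3 × (κ → Bool))),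
        l.IsReducedModel ⟨_, ne, S⟩ {b | b.1 = 0} ∧ l.IsReducedModel ⟨_, ne, S⟩ {b | b.1 ≠ 2} := by
  classical
  obtain ⟨A, F, G, hF, hG, hFG, g, hgG, hgF⟩ := exists_two_reduced h
  obtain ⟨f, hf⟩ := hl.exists_mem hF.1
  have hfg : f ≠ g := fun h => hgF (h ▸ hf)
  obtain ⟨o, ho⟩ := hG.exists_notMem hfg
  refine ⟨A.carrier, fun κ _ hκ => ?_⟩
  let P := A.carrier × (κ → A.carrier)
  let cls : P → Fin 3 := fun p =>
    if p.1 ∈ G ∧ ∀ k, p.2 k ∈ G then (if p.1 ∈ F then 0 else 1) else 2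
  have hP : #P ≤ #(κ → Bool) := by
    have h2 : #A.carrier ≤ 2 ^ #κ := hκ.trans (cantor _).le
    have hinf : ℵ₀ ≤ #κ := aleph0_le_mk κ
    have : #(κ → Bool) = 2 ^ #κ := by simp
    rw [this, mk_prod, lift_id, lift_id, ← power_def]
    calc #A.carrier * #A.carrier ^ #κ ≤ 2 ^ #κ * (2 ^ #κ) ^ #κ :=
          mul_le_mul' h2 (power_le_power_right h2)
      _ = 2 ^ #κ := by
          rw [← power_mul, mul_eq_self hinf, mul_eq_self (hinf.trans (cantor _).le)]
  have hfib : ∀ c, Nonempty ({p : P // cls p = c} ≃ (κ → Bool)) := by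
    intro c
    rw [← Cardinal.eq]
    refine le_antisymm ((mk_subtype_le _).trans hP) ?_
    let w : (κ → Bool) → κ → A.carrier := fun s k => if s k then f else g
    have hw : Function.Injective w := by
      intro s s' hs
      funext k
      have := congrFun hs k
      simp only [w] at this
      cases h1 : s k <;> cases h2 : s' k <;> simp [h1, h2, hfg, hfg.symm] at this ⊢
    have hwG : ∀ s k, w s k ∈ G := fun s k => by
      simp only [w]; split_ifs; exacts [hFG hf, hgG]
    have hx : ∃ x, ∀ s, cls (x, w s) = c := by
      fin_cases c
      · exact ⟨f, fun s => by simp [cls, hf, hFG hf, hwG]⟩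
      · exact ⟨g, fun s => by simp [cls, hgF, hgG, hwG]⟩
      · exact ⟨o, fun s => by simp [cls, ho]⟩
    obtain ⟨x, hx⟩ := hx
    exact mk_le_of_injective (f := fun s => ⟨(x, w s), hx s⟩) fun s s' hs =>
      hw (congrArg (fun p => p.1.2) hs)
  let e : P ≃ Fin 3 × (κ → Bool) := (Equiv.sigmaFiberEquiv cls).symm.trans
    ((Equiv.sigmaCongrRight fun c => (hfib c).some).trans (Equiv.sigmaEquivProd _ _))
  have he : ∀ b, cls (e.symm b) = b.1 := by
    intro b
    obtain ⟨p, rfl⟩ := e.surjective b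
    rw [e.symm_apply_apply]
    rfl
  let π : Option κ → Fin 3 × (κ → Bool) → A.carrier := fun i b =>
    i.elim (e.symm b).1 (e.symm b).2
  let S : l.lang.Structure (Fin 3 × (κ → Bool)) :=
    { funMap := fun f x => e (A.op f fun i => π none (x i), fun k => A.op f fun i => π (some k) (x i))
      RelMap := fun {n} r _ => ((l.algebraic n).false r).elim }
  have ne : Nonempty (Fin 3 × (κ → Bool)) := inferInstance
  have hπ : ∀ i, IsHom ⟨_, ne, S⟩ A (π i) := by
    intro i n f x
    change i.elim (e.symm (e _)).1 (e.symm (e _)).2 = _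
    rw [e.symm_apply_apply]
    cases i <;> rfl
  have hsurj : ∀ i, Function.Surjective (π i) := by
    intro i a
    refine ⟨e (a, fun _ => a), ?_⟩
    change i.elim (e.symm (e _)).1 (e.symm (e _)).2 = _
    rw [e.symm_apply_apply]
    cases i <;> rfl
  have hinj : ∀ a b, (∀ i, π i a = π i b) → a = b := fun a b hab =>
    e.symm.injective (Prod.ext (hab none) (funext fun k => hab (some k)))
  refine ⟨ne, S, ?_, ?_⟩
  · have := isReducedModel_of_subdirect (A := ⟨_, ne, S⟩) (fun _ : Option κ => A)
      (fun i => i.elim F fun _ => G) (by rintro (_ | _); exacts [hF, hG]) π hπ hsurj hinj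
    convert this using 1
    ext b
    have hb := he b
    simp only [Set.mem_ofPred_eq, Set.mem_iInter, Option.forall, Set.mem_preimage, Option.elim, π,
      ← hb, cls]
    have := @hFG (e.symm b).1
    generalize (∀ k, (e.symm b).2 k ∈ G) = q
    by_cases h₁ : (e.symm b).1 ∈ G <;> by_cases h₂ : (e.symm b).1 ∈ F <;> by_cases q <;> simp_all
  · have := isReducedModel_of_subdirect (A := ⟨_, ne, S⟩) (fun _ : Option κ => A)
      (fun _ => G) (fun _ => hG) π hπ hsurj hinj
    convert this using 1
    ext b
    have hb := he b
    simp only [Set.mem_ofPred_eq, Set.mem_iInter, Option.forall, Set.mem_preimage, Option.elim, π,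
      ← hb, cls]
    generalize (∀ k, (e.symm b).2 k ∈ G) = q
    by_cases h₁ : (e.symm b).1 ∈ G <;> by_cases h₂ : (e.symm b).1 ∈ F <;> by_cases q <;> simp_all

end Logic

/-! ### Logics of classes of matrices -/

/-- A substitution invariant consequence relation on the `L`-terms in the variables `V`. In contrast
to `Logic`, the language and the variables are fixed, so that these form a type in `Type u`. -/
structure Consequence (L : FirstOrder.Language.{u, 0}) (V : Type u) : Type u where
  entails : Set (L.Term V) → L.Term V → Prop
  entails_of_mem : ∀ (Γ : Set (L.Term V)) (φ : L.Term V), φ ∈ Γ → entails Γ φ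
  entails_cut : ∀ (Γ Δ : Set (L.Term V)) (φ : L.Term V),
    (∀ δ ∈ Δ, entails Γ δ) → entails Δ φ → entails Γ φ
  entails_subst : ∀ (σ : V → L.Term V) (Γ : Set (L.Term V)) (φ : L.Term V),
    entails Γ φ → entails ((fun γ => γ.subst σ) '' Γ) (φ.subst σ)

/-- A consequence relation regarded as a logic. -/
abbrev Consequence.toLogic {V : Type u} (c : Consequence L V) (hL : L.IsAlgebraic)
    (h₀ : IsEmpty (L.Functions 0)) (hV : Infinite V) : Logic.{u} where
  lang := L
  algebraic := hL
  no_constants := h₀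
  Var := V
  infinite_var := hV
  entails := c.entails
  entails_of_mem := c.entails_of_mem
  entails_cut := c.entails_cut
  entails_subst := c.entails_subst

/-- The consequence relation of the family of matrices `⟨A i, F i⟩`. -/
def matrixConsequence (V : Type u) {ι : Type*} (A : ι → Alg.{u} L) (F : ∀ i, Set (A i).carrier) :
    Consequence L V where
  entails Γ φ := ∀ (i : ι) (v : V → (A i).carrier),
    (∀ γ ∈ Γ, (A i).eval v γ ∈ F i) → (A i).eval v φ ∈ F i
  entails_of_mem _ φ h _ _ hv := hv φ h
  entails_cut _ _ _ h h' i v hv := h' i v fun δ hδ => h δ hδ i v hv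
  entails_subst σ Γ φ h i v hv := by
    rw [Alg.eval_subst]
    refine h i _ fun γ hγ => ?_
    rw [← Alg.eval_subst]
    exact hv _ (Set.mem_image_of_mem _ hγ)

section Matrix

variable {V : Type u} {ι : Type*} {A : ι → Alg.{u} L} {F : ∀ i, Set (A i).carrier}
  {hL : L.IsAlgebraic} {h₀ : IsEmpty (L.Functions 0)} {hV : Infinite V}

theorem isFilter_matrixConsequence (i : ι) :
    ((matrixConsequence V A F).toLogic hL h₀ hV).IsFilter (A i) (F i) :=
  fun _ _ hΓ v hv => hΓ i v hv

/-- The filters of the logic of a family of matrices are closed under all rules valid in these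
matrices, whatever the names of the variables in the rules. -/
theorem isFilter_of_valid {C : Alg.{u} L} {H : Set C.carrier}
    (hH : ((matrixConsequence V A F).toLogic hL h₀ hV).IsFilter C H) {W : Type*} (e : W ↪ V)
    {Γ : Set (L.Term W)} {φ : L.Term W}
    (hval : ∀ (i : ι) (w : W → (A i).carrier),
      (∀ γ ∈ Γ, (A i).eval w γ ∈ F i) → (A i).eval w φ ∈ F i)
    (w : W → C.carrier) (hw : ∀ γ ∈ Γ, C.eval w γ ∈ H) : C.eval w φ ∈ H := by
  obtain ⟨c⟩ := C.nonempty
  let v : V → C.carrier := Function.extend e w fun _ => c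
  have hv : ∀ t : L.Term W, C.eval v (t.relabel e) = C.eval w t := fun t => by
    rw [Alg.eval_relabel]
    congr 1
    funext x
    exact e.injective.extend_apply w _ x
  rw [← hv]
  refine hH ((fun γ => γ.relabel e) '' Γ) _ (fun i v hv => ?_) v ?_
  · rw [Alg.eval_relabel]
    refine hval i _ fun γ hγ => ?_
    rw [← Alg.eval_relabel]
    exact hv _ (Set.mem_image_of_mem _ hγ)
  · rintro _ ⟨γ, hγ, rfl⟩
    exact (hv γ).symm ▸ hw γ hγ

end Matrix

/-- Every countable type of variable names embeds into an infinite set of variables. -/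
theorem exists_embedding (W : Type) [Encodable W] (V : Type u) [Infinite V] : Nonempty (W ↪ V) :=
  ⟨(⟨Encodable.encode, Encodable.encode_injective⟩ : W ↪ ℕ).trans (Infinite.natEmbedding V)⟩

/-! ### A common non-truth-equational upper bound -/

/-- The language with a symbol for each operation of positive arity on `B`. -/
abbrev opLang (B : Type u) : FirstOrder.Language.{u, 0} where
  Functions n := {_f : (Fin n → B) → B // 0 < n}
  Relations _ := Empty

theorem isAlgebraic_opLang (B : Type u) : (opLang B).IsAlgebraic :=
  fun _ => inferInstanceAs (IsEmpty Empty)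

theorem isEmpty_opLang_functions (B : Type u) : IsEmpty ((opLang B).Functions 0) :=
  ⟨fun f => f.2.false⟩

/-- The set `B` with all its operations. -/
abbrev opAlg (B : Type u) (ne : Nonempty B) : Alg.{u} (opLang B) where
  carrier := B
  nonempty := ne
  str :=
    { funMap := fun f x => f.1 x
      RelMap := fun r _ => Empty.elim r }

/-- The logic of the two matrices `⟨B, F⟩` and `⟨B, G⟩`, where `B` carries all its operations. -/
abbrev pairLogic (B : Type u) (ne : Nonempty B) (F G : Set B) (V : Type u) (hV : Infinite V) :
    Logic.{u} :=
  (matrixConsequence (ι := {K : Set B // K = F ∨ K = G}) V (fun _ => opAlg B ne)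
    fun K => K.1).toLogic (isAlgebraic_opLang B) (isEmpty_opLang_functions B) hV

section Pair

variable {B : Type u} {ne : Nonempty B} {F G : Set B} {V : Type u} {hV : Infinite V}

/-- The term `b(s, t)`, for a binary operation `b` on `B`. -/
def binTerm {X : Type*} (b : B → B → B) (s t : (opLang B).Term X) : (opLang B).Term X :=
  .func (⟨fun x => b (x 0) (x 1), Nat.two_pos⟩ : (opLang B).Functions 2) ![s, t]

/-- The value of the binary symbol `b`. -/
def Alg.bin (C : Alg.{u} (opLang B)) (b : B → B → B) (x y : C.carrier) : C.carrier :=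
  C.op (⟨fun x => b (x 0) (x 1), Nat.two_pos⟩ : (opLang B).Functions 2) ![x, y]

theorem eval_binTerm (C : Alg.{u} (opLang B)) {X : Type*} (v : X → C.carrier) (b : B → B → B)
    (s t : (opLang B).Term X) :
    C.eval v (binTerm b s t) = C.bin b (C.eval v s) (C.eval v t) := by
  rw [binTerm, Alg.eval_func, Alg.bin]
  congr 1
  funext i
  fin_cases i <;> rfl

theorem bin_opAlg (b : B → B → B) (x y : B) : (opAlg B ne).bin b x y = b x y := rfl

/-- The constant `c` of `B` as a term. Since there are no constant symbols, it is rendered as a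
constant unary operation applied to a term `s`. -/
def constTerm {X : Type*} (c : B) (s : (opLang B).Term X) : (opLang B).Term X :=
  .func (⟨fun _ => c, Nat.one_pos⟩ : (opLang B).Functions 1) fun _ => s

theorem isReducedModel_pairLogic {K : Set B} (hK : K = F ∨ K = G) {p q : B} (hp : p ∈ K)
    (hq : q ∉ K) : (pairLogic B ne F G V hV).IsReducedModel (opAlg B ne) K := by
  classical
  have hF : (pairLogic B ne F G V hV).IsFilter (opAlg B ne) K :=
    isFilter_matrixConsequence (⟨K, hK⟩ : {K : Set B // K = F ∨ K = G})
  refine ⟨hF, fun a b hab => ?_⟩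
  by_contra hne
  obtain ⟨θ, hθ, hc, h⟩ := hab K hF subset_rfl
  -- The operation that tests equality with `a` would identify `p` and `q`.
  have : θ (if a = a then p else q) (if b = a then p else q) :=
    hθ 1 ⟨fun x => if x 0 = a then p else q, Nat.one_pos⟩ (fun _ => a) (fun _ => b) fun _ => h
  refine hq (hc p q ?_ hp)
  simpa [Ne.symm hne] using this

theorem not_isTruthEquational_pairLogic {f g o : B} (hf : f ∈ F) (hFG : F ⊆ G) (hg : g ∈ G)
    (hgF : g ∉ F) (ho : o ∉ G) : ¬ (pairLogic B ne F G V hV).IsTruthEquational := by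
  rintro ⟨E, hE⟩
  have h₁ := hE _ F (isReducedModel_pairLogic (.inl rfl) hf hgF) g
  have h₂ := hE _ G (isReducedModel_pairLogic (.inr rfl) (hFG hf) ho) g
  exact hgF (h₁.2 (h₂.1 hg))

/-- Pairs that pass an equality test are Suszko congruent in the logic of the two matrices. -/
theorem suszko_pairLogic_of_bin_mem {Δ : B → B → B}
    (hΔ : ∀ K : Set B, K = F ∨ K = G → ∀ x y, Δ x y ∈ K → x = y)
    {C : Alg.{u} (opLang B)} {H : Set C.carrier} {a b : C.carrier} (hab : C.bin Δ a b ∈ H) :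
    (pairLogic B ne F G V hV).Suszko C H a b := by
  intro H' hH' hHH'
  obtain ⟨e⟩ := exists_embedding (Bool ⊕ ℕ) V
  rw [leibniz_iff]
  intro t v
  -- The rule that replaces `x` by `y` in a term `t`, given that `Δ(x, y)` is true.
  have key : ∀ i j : Bool, C.eval (fun o => o.elim (cond i b a) v) t ∈ H' →
      C.eval (fun o => o.elim (cond j b a) v) t ∈ H' := by
    intro i j hi
    let r : Bool → (opLang B).Term (Bool ⊕ ℕ) := fun i =>
      t.relabel fun o => o.elim (Sum.inl i) Sum.inr
    let w : Bool ⊕ ℕ → C.carrier := Sum.elim (fun i => cond i b a) v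
    have hr : ∀ i, C.eval w (r i) = C.eval (fun o => o.elim (cond i b a) v) t := fun i => by
      rw [Alg.eval_relabel]
      congr 1
      funext o
      cases o <;> rfl
    rw [← hr] at hi ⊢
    refine isFilter_of_valid hH' e
      (Γ := {r i, binTerm Δ (.var (.inl false)) (.var (.inl true))}) ?_ w ?_
    · rintro ⟨K, hK⟩ w' hw
      have h₁ := hw _ (Set.mem_insert _ _)
      have h₂ := hw _ (Set.mem_insert_of_mem _ rfl)
      rw [eval_binTerm, bin_opAlg] at h₂
      have heq : w' (.inl false) = w' (.inl true) := hΔ K hK _ _ h₂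
      have : ∀ i, (opAlg B ne).eval w' (r i) =
          (opAlg B ne).eval (fun o => o.elim (w' (.inl true)) fun m => w' (.inr m)) t := fun i => by
        rw [Alg.eval_relabel]
        congr 1
        funext o
        cases o
        · cases i
          · exact heq
          · rfl
        · rfl
      rw [this] at h₁ ⊢
      exact h₁
    · rintro γ (rfl | rfl)
      · exact hi
      · rw [eval_binTerm]
        exact hHH' hab
  exact ⟨key false true, key true false⟩

variable {l : Logic.{u}} {S : l.lang.Structure B}

/-- The translation of the symbols of `l` into symbols for their interpretations in `B`. -/
def opTranslation (l : Logic.{u}) (S : l.lang.Structure B) : Translation l.lang (opLang B) :=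
  fun n f => .func (⟨fun x => S.funMap f x,
    Nat.pos_of_ne_zero fun h => l.no_constants.false (h ▸ f)⟩ : (opLang B).Functions n) .var

theorem eval_opTranslation {X : Type*} (v : X → B) (t : l.lang.Term X) :
    (opAlg B ne).eval v ((opTranslation l S).onTerm t) = Alg.eval ⟨B, ne, S⟩ v t := by
  rw [Translation.eval_onTerm l.algebraic]
  exact IsHom.eval (A := (opTranslation l S).reduct l.algebraic (opAlg B ne)) (B := ⟨B, ne, S⟩)
    (h := id) (fun _ _ _ => rfl) v t

/-- If the sections of the term `s` in the two matrices are filters of `l`, then so are its sections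
in all models. -/
theorem isFilter_section (e : Option l.Var ↪ V) (s : (opLang B).Term Bool)
    (hs : ∀ K : Set B, K = F ∨ K = G → ∀ x : B,
      l.IsFilter ⟨B, ne, S⟩ {z | (opAlg B ne).eval (fun i => cond i z x) s ∈ K})
    {C : Alg.{u} (opLang B)} {H : Set C.carrier}
    (hH : (pairLogic B ne F G V hV).IsFilter C H) (x : C.carrier) :
    l.IsFilter ((opTranslation l S).reduct l.algebraic C)
      {z | C.eval (fun i => cond i z x) s ∈ H} := by
  intro Γ φ hΓ v hv
  let r : l.lang.Term l.Var → (opLang B).Term (Option l.Var) := fun γ =>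
    s.subst fun i => cond i (((opTranslation l S).onTerm γ).relabel some) (.var none)
  have hr : ∀ (D : Alg.{u} (opLang B)) (w : Option l.Var → D.carrier) γ,
      D.eval w (r γ) = D.eval (fun i => cond i
        (D.eval (fun y => w (some y)) ((opTranslation l S).onTerm γ)) (w none)) s := by
    intro D w γ
    rw [Alg.eval_subst]
    congr 1
    funext i
    cases i
    · rfl
    · exact D.eval_relabel _ _ _
  have hC : ∀ γ, C.eval (fun o => o.elim x v) (r γ) = C.eval (fun i => cond i
      (Alg.eval ((opTranslation l S).reduct l.algebraic C) v γ) x) s := fun γ => by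
    rw [hr, Translation.eval_onTerm l.algebraic]
    rfl
  change C.eval _ s ∈ H
  rw [← hC]
  refine isFilter_of_valid hH e (Γ := r '' Γ) ?_ _ ?_
  · rintro ⟨K, hK⟩ w hw
    rw [hr, eval_opTranslation]
    refine hs K hK (w none) Γ φ hΓ _ fun γ hγ => ?_
    have := hw _ (Set.mem_image_of_mem r hγ)
    rwa [hr, eval_opTranslation] at this
  · rintro _ ⟨γ, hγ, rfl⟩
    rw [hC]
    exact hv γ hγ

/-- If two comparable filters of `l` on `B` are reduced, then `l` is interpretable in the logic of
the corresponding two matrices with all operations on `B`.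

The Suszko congruence of `l` on a model `⟨C, H⟩` of the latter logic is contained in that of the
latter logic because `H` and the filters of `l` above it are definable: For a filter `K ⊇ F` of `l`
on `B` there is a binary operation `imp K` such that in every model `{z | imp K (x, z) ∈ H}` is a
filter of `l` that extends `H` and contains `x`.  Therefore the rule
`{imp K (p(x), p(y)), imp K (p(y), p(x)) : K, p} ⊢ Δ(x, y)`, where `p` runs through the unary
polynomials of `l` on `B` and `Δ` tests equality, applies to Suszko congruent elements. -/
theorem le_pairLogic (e : Option l.Var ↪ V) (hF : l.IsReducedModel ⟨B, ne, S⟩ F)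
    (hG : l.IsReducedModel ⟨B, ne, S⟩ G) {f g o : B} (hf : f ∈ F) (hFG : F ⊆ G) (hg : g ∈ G)
    (hgF : g ∉ F) (ho : o ∉ G) : l ≤ pairLogic B ne F G V hV := by
  classical
  let Δ : B → B → B := fun x y => if x = y then f else o
  -- The section at `x ∈ K` is `K` in `⟨B, F⟩`; in `⟨B, G⟩` it is `K` if `G ⊆ K`, and else `B`.
  let imp : Set B → B → B → B := fun K x z =>
    if x ∈ K ∧ z ∉ K then (if G ⊆ K then o else g) else f
  have hcase : ∀ K : Set B, K = F ∨ K = G → f ∈ K ∧ o ∉ K ∧ F ⊆ K ∧ K ⊆ G ∧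
      l.IsReducedModel ⟨B, ne, S⟩ K := by
    rintro K (rfl | rfl)
    · exact ⟨hf, fun h => ho (hFG h), subset_rfl, hFG, hF⟩
    · exact ⟨hFG hf, ho, hFG, subset_rfl, hG⟩
  have hΔ : ∀ K : Set B, K = F ∨ K = G → ∀ x y, Δ x y ∈ K → x = y := by
    intro K hK x y h
    by_contra hxy
    simp only [Δ, if_neg hxy] at h
    exact (hcase K hK).2.1 h
  have himp : ∀ M K : Set B, K = F ∨ K = G → F ⊆ M → ∀ x z,
      imp M x z ∈ K ↔ (x ∈ M → z ∈ M) ∨ (K = G ∧ ¬ G ⊆ M) := by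
    intro M K hK hM x z
    have hK' := hcase K hK
    by_cases hxz : x ∈ M ∧ z ∉ M
    · have hn : ¬ (x ∈ M → z ∈ M) := fun h => hxz.2 (h hxz.1)
      by_cases hGM : G ⊆ M
      · simp [imp, hxz, hGM, hK'.2.1]
      · rcases hK with rfl | rfl
        · have : K ≠ G := fun h => hgF (h ▸ hg)
          simp [imp, hxz, hGM, hgF, this]
        · simp [imp, hxz, hGM, hg]
    · have hn : x ∈ M → z ∈ M := fun h => by_contra fun h' => hxz ⟨h, h'⟩
      simp only [imp, if_neg hxz, hK'.1, true_iff]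
      exact .inl hn
  let τ := opTranslation l S
  have hsec : ∀ {C : Alg.{u} (opLang B)} {H : Set C.carrier},
      (pairLogic B ne F G V hV).IsFilter C H → ∀ M, l.IsFilter ⟨B, ne, S⟩ M → F ⊆ M →
      ∀ x, l.IsFilter (τ.reduct l.algebraic C) {z | C.bin (imp M) x z ∈ H} := by
    intro C H hH M hM hFM x
    have := isFilter_section (S := S) e (binTerm (imp M) (.var false) (.var true)) ?_ hH x
    · simpa only [eval_binTerm, Alg.eval_var, cond] using this
    · intro K hK x Γ φ hΓ v hv
      simp only [eval_binTerm, Alg.eval_var, cond, bin_opAlg, Set.mem_ofPred_eq,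
        himp M K hK hFM] at hv ⊢
      by_cases hKM : K = G ∧ ¬ G ⊆ M
      · exact .inr hKM
      · simp only [hKM, or_false] at hv ⊢
        exact fun hx => hM Γ φ hΓ v fun γ hγ => hv γ hγ hx
  have eB : Bool ↪ V := (exists_embedding Bool V).some
  refine ⟨τ, fun C H hH => ⟨?_, fun a b hab => hH.2 a b (suszko_pairLogic_of_bin_mem hΔ ?_)⟩⟩
  · exact isFilter_section (S := S) e (.var true) (fun K hK _ => (hcase K hK).2.2.2.2.1) hH.1
      C.nonempty.some
  -- `P p c i` is the polynomial with the term `p` and the parameters `c`, applied to the variable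
  -- `i`.
  let P : l.lang.Term (Option ℕ) → (ℕ → B) → Bool → (opLang B).Term Bool := fun p c i =>
    (τ.onTerm p).subst fun o => o.elim (.var i) fun k => constTerm (c k) (.var false)
  have hPB : ∀ p c i (v : Bool → B), (opAlg B ne).eval v (P p c i) =
      Alg.eval ⟨B, ne, S⟩ (fun o => o.elim (v i) c) p := by
    intro p c i v
    rw [Alg.eval_subst, eval_opTranslation]
    congr 1
    funext o
    cases o <;> rfl
  let v : Bool → C.carrier := fun i => cond i b a
  have hPC : ∀ p c i, C.eval v (P p c i) = (τ.reduct l.algebraic C).eval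
      (fun o => o.elim (v i) fun k => C.eval v (constTerm (c k) (.var false))) p := by
    intro p c i
    rw [Alg.eval_subst, Translation.eval_onTerm l.algebraic]
    congr 1
    funext o
    cases o <;> rfl
  have := isFilter_of_valid hH.1 eB (φ := binTerm Δ (.var false) (.var true))
    (Γ := {t | ∃ M, l.IsFilter ⟨B, ne, S⟩ M ∧ F ⊆ M ∧ ∃ p c i,
      t = binTerm (imp M) (P p c i) (P p c !i)}) ?_ v ?_
  · rwa [eval_binTerm] at this
  · rintro ⟨K, hK⟩ w hw
    obtain ⟨hfK, -, hFK, -, hred⟩ := hcase K hK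
    have heq : w false = w true := by
      refine hred.2 _ _ fun M hM hKM => leibniz_iff.2 fun p c => ?_
      have key : ∀ i, Alg.eval ⟨B, ne, S⟩ (fun o => o.elim (w i) c) p ∈ M →
          Alg.eval ⟨B, ne, S⟩ (fun o => o.elim (w !i) c) p ∈ M := by
        intro i
        have := hw _ ⟨M, hM, hFK.trans hKM, p, c, i, rfl⟩
        rw [eval_binTerm, bin_opAlg, hPB, hPB] at this
        rcases (himp M K hK (hFK.trans hKM) _ _).1 this with h | ⟨rfl, h⟩
        · exact h
        · exact (h hKM).elim
      exact ⟨key false, key true⟩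
    rw [eval_binTerm, bin_opAlg]
    change Δ (w false) (w true) ∈ K
    rw [heq]
    simpa [Δ] using hfK
  · rintro _ ⟨M, hM, hFM, p, c, i, rfl⟩
    rw [eval_binTerm]
    let x := C.eval v (P p c i)
    have hsub : H ⊆ {z | C.bin (imp M) x z ∈ H} := by
      intro z hz
      have := isFilter_of_valid hH.1 eB (Γ := {.var true})
        (φ := binTerm (imp M) (.var false) (.var true)) ?_ (fun i => cond i z x) ?_
      · rwa [eval_binTerm] at this
      · rintro ⟨K, hK⟩ w hw
        have hwt : w true ∈ K := hw _ rfl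
        rw [eval_binTerm, bin_opAlg]
        refine (himp M K hK hFM _ _).2 ?_
        rcases hK with rfl | rfl
        · exact .inl fun _ => hFM hwt
        · by_cases hKM : K ⊆ M
          · exact .inl fun _ => hKM hwt
          · exact .inr ⟨rfl, hKM⟩
      · rintro _ rfl
        exact hz
    have hx : C.bin (imp M) x x ∈ H := by
      have := isFilter_of_valid hH.1 eB (Γ := ∅)
        (φ := binTerm (imp M) (.var false) (.var false)) ?_ (fun _ => x) fun _ h => h.elim
      · rwa [eval_binTerm] at this
      · rintro ⟨K, hK⟩ w -
        rw [eval_binTerm, bin_opAlg]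
        exact (himp M K hK hFM _ _).2 (.inl id)
    have hLeib := leibniz_iff.1 (hab _ (hsec hH.1 M hM hFM x) hsub) p
      fun k => C.eval v (constTerm (c k) (.var false))
    change C.eval v (P p c !i) ∈ {z | C.bin (imp M) x z ∈ H}
    have hx' : C.eval v (P p c i) ∈ {z | C.bin (imp M) x z ∈ H} := hx
    rw [hPC] at hx' ⊢
    cases i
    · exact hLeib.1 hx'
    · exact hLeib.2 hx'

end Pair

open Cardinal in
/-- Two logics with theorems that are not truth-equational have a common upper bound with the same
property. -/
theorem exists_not_isTruthEquational_ge {l₁ l₂ : Logic.{u}} (h₁ : l₁.HasTheorems)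
    (h₂ : l₂.HasTheorems) (h₁' : ¬ l₁.IsTruthEquational) (h₂' : ¬ l₂.IsTruthEquational) :
    ∃ l : Logic.{u}, l₁ ≤ l ∧ l₂ ≤ l ∧ ¬ l.IsTruthEquational := by
  obtain ⟨X₁, hX₁⟩ := Logic.exists_two_reduced_on h₁ h₁'
  obtain ⟨X₂, hX₂⟩ := Logic.exists_two_reduced_on h₂ h₂'
  let κ : Type u := (X₁ ⊕ X₂) ⊕ ULift.{u} ℕ
  obtain ⟨ne, S₁, hF₁, hG₁⟩ := hX₁ κ inferInstance
    (mk_le_of_injective (Sum.inl_injective.comp Sum.inl_injective))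
  obtain ⟨_, S₂, hF₂, hG₂⟩ := hX₂ κ inferInstance
    (mk_le_of_injective (Sum.inl_injective.comp Sum.inr_injective))
  have := l₁.infinite_var
  let V : Type u := Option l₁.Var ⊕ Option l₂.Var
  have hV : Infinite V := inferInstance
  let s : κ → Bool := fun _ => true
  have hf : ((0, s) : Fin 3 × (κ → Bool)) ∈ {b : Fin 3 × (κ → Bool) | b.1 = 0} := rfl
  have hg : ((1, s) : Fin 3 × (κ → Bool)) ∈ {b : Fin 3 × (κ → Bool) | b.1 ≠ 2} := by simp
  have hgF : ((1, s) : Fin 3 × (κ → Bool)) ∉ {b : Fin 3 × (κ → Bool) | b.1 = 0} := by simp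
  have ho : ((2, s) : Fin 3 × (κ → Bool)) ∉ {b : Fin 3 × (κ → Bool) | b.1 ≠ 2} := by simp
  have hFG : {b : Fin 3 × (κ → Bool) | b.1 = 0} ⊆ {b | b.1 ≠ 2} := by
    intro b (hb : b.1 = 0)
    simp [hb]
  exact ⟨pairLogic _ ne _ _ V hV,
    le_pairLogic Function.Embedding.inl hF₁ hG₁ hf hFG hg hgF ho,
    le_pairLogic Function.Embedding.inr hF₂ hG₂ hf hFG hg hgF ho,
    not_isTruthEquational_pairLogic hf hFG hg hgF ho⟩

/-! ### Lower bounds of families of truth-equational logics -/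

/-- Data that allow to combine a family of logics into one with the language `L` and the variables
`V`: translations `τ i` of `L`, symbols `σ i f` of `L` that `τ i` translates as `f` and every other
`τ j` as a projection, binary symbols `sel i` that `τ i` translates as the second projection and
every other `τ j` as the first one, and a unary symbol `thm` that is always translated as a
theorem. -/
structure Combination {I : Type*} (l : I → Logic.{u}) (L : FirstOrder.Language.{u, 0})
    (V : Type u) where
  algebraic : L.IsAlgebraic
  no_constants : IsEmpty (L.Functions 0)
  infinite_var : Infinite V
  emb : ∀ i, Option (l i).Var ↪ V
  τ : ∀ i, Translation L (l i).lang
  σ : ∀ i n, (l i).lang.Functions n → L.Functions n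
  sel : I → L.Functions 2
  thm : L.Functions 1
  τ_σ : ∀ i n f, τ i n (σ i n f) = .func f .var
  τ_σ_of_ne : ∀ i j, i ≠ j → ∀ n f, ∃ k, τ j n (σ i n f) = .var k
  τ_sel : ∀ i, τ i 2 (sel i) = .var 1
  τ_sel_of_ne : ∀ i j, i ≠ j → τ j 2 (sel i) = .var 0
  τ_thm : ∀ i (A : Alg.{u} (l i).lang) F, (l i).IsFilter A F →
    ∀ v, A.eval v (τ i 1 thm) ∈ F

namespace Combination

variable {I : Type*} {l : I → Logic.{u}} {V : Type u} (D : Combination l L V)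

/-- The reduct of `A` along `τ i`, with a universe that is reducible to the one of `A`. -/
abbrev red (i : I) (A : Alg.{u} (l i).lang) : Alg.{u} L where
  carrier := A.carrier
  nonempty := A.nonempty
  str := ((D.τ i).reduct D.algebraic A).str

/-- The consequence relation of all reducts `⟨A^(τ i), F⟩` of models `⟨A, F⟩` of the logics
`l i`. -/
def consequence : Consequence L V :=
  matrixConsequence (ι := Σ i, {P : Σ A : Alg.{u} (l i).lang, Set A.carrier //
    (l i).IsFilter P.1 P.2}) V (fun P => D.red P.1 P.2.1.1) fun P => P.2.1.2

/-- The logic of all reducts `⟨A^(τ i), F⟩` of models `⟨A, F⟩` of the logics `l i`. -/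
abbrev logic : Logic.{u} := D.consequence.toLogic D.algebraic D.no_constants D.infinite_var

theorem isFilter_logic (i : I) {A : Alg.{u} (l i).lang} {F : Set A.carrier}
    (hF : (l i).IsFilter A F) : D.logic.IsFilter (D.red i A) F :=
  isFilter_matrixConsequence (A := fun P : Σ i, {P : Σ A : Alg.{u} (l i).lang, Set A.carrier //
    (l i).IsFilter P.1 P.2} => D.red P.1 P.2.1.1) (F := fun P => P.2.1.2)
    (⟨i, ⟨A, F⟩, hF⟩ : Σ i, {P : Σ A : Alg.{u} (l i).lang, Set A.carrier //
    (l i).IsFilter P.1 P.2})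

theorem of_valid {C : Alg.{u} L} {H : Set C.carrier} (hH : D.logic.IsFilter C H) {W : Type*}
    (e : W ↪ V) {Γ : Set (L.Term W)} {φ : L.Term W}
    (hval : ∀ (i : I) (A : Alg.{u} (l i).lang) (F : Set A.carrier), (l i).IsFilter A F →
      ∀ w : W → A.carrier, (∀ γ ∈ Γ, (D.red i A).eval w γ ∈ F) →
        (D.red i A).eval w φ ∈ F)
    (w : W → C.carrier) (hw : ∀ γ ∈ Γ, C.eval w γ ∈ H) : C.eval w φ ∈ H :=
  isFilter_of_valid hH e (fun P w hw => hval P.1 P.2.1.1 P.2.1.2 P.2.2 w hw) w hw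

theorem logic_le (i : I) : D.logic ≤ l i := by
  refine ⟨D.τ i, fun A F hF => ⟨D.isFilter_logic i hF.1, fun a b hab =>
    hF.2 a b fun G hG hFG => ?_⟩⟩
  obtain ⟨θ, hθ, hc, h⟩ := hab G (D.isFilter_logic i hG) hFG
  refine ⟨θ, fun n f x y hxy => ?_, hc, h⟩
  have := hθ n (D.σ i n f) x y hxy
  change θ (A.eval x (D.τ i n (D.σ i n f))) (A.eval y (D.τ i n (D.σ i n f))) at this
  rwa [D.τ_σ] at this

/-- The translation of the language of `l i` into `L` given by the symbols `σ i f`. -/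
def incl (i : I) : Translation (l i).lang L := fun n f => .func (D.σ i n f) .var

theorem eval_incl (i : I) (A : Alg.{u} (l i).lang) {X : Type*} (v : X → A.carrier)
    (t : (l i).lang.Term X) :
    (D.red i A).eval v ((D.incl i).onTerm t) = A.eval v t := by
  rw [Translation.eval_onTerm (l i).algebraic]
  refine IsHom.eval
    (A := (D.incl i).reduct (l i).algebraic (D.red i A)) (B := A)
    (h := id) (fun n f x => ?_) v t
  change A.eval x (D.τ i n (D.σ i n f)) = _
  rw [D.τ_σ]
  rfl

theorem eval_incl_of_ne {i j : I} (hij : i ≠ j) (A : Alg.{u} (l j).lang) {X : Type*}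
    (a : A.carrier) (t : (l i).lang.Term X) :
    (D.red j A).eval (fun _ => a) ((D.incl i).onTerm t) = a := by
  rw [Translation.eval_onTerm (l i).algebraic]
  induction t with
  | var x => rfl
  | func f ts ih =>
    obtain ⟨k, hk⟩ := D.τ_σ_of_ne i j hij _ f
    change A.eval _ (D.τ j _ (D.σ i _ f)) = a
    rw [hk]
    exact ih k

theorem op_sel (i : I) (A : Alg.{u} (l i).lang) (x : Fin 2 → A.carrier) :
    (D.red i A).op (D.sel i) x = x 1 := by
  change A.eval x (D.τ i 2 (D.sel i)) = _
  rw [D.τ_sel]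
  rfl

theorem op_sel_of_ne {i j : I} (hij : i ≠ j) (A : Alg.{u} (l j).lang) (x : Fin 2 → A.carrier) :
    (D.red j A).op (D.sel i) x = x 0 := by
  change A.eval x (D.τ j 2 (D.sel i)) = _
  rw [D.τ_sel_of_ne i j hij]
  rfl

/-- The section of a filter at `w` by the symbol `sel i` is a filter of `l i`. -/
theorem isFilter_sel {C : Alg.{u} L} {H : Set C.carrier} (hH : D.logic.IsFilter C H) {w : C.carrier}
    (hw : w ∈ H) (i : I) : (l i).IsFilter ((D.incl i).reduct (l i).algebraic C)
      {z | C.op (D.sel i) ![w, z] ∈ H} := by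
  intro Γ φ hΓ v hv
  let r : (l i).lang.Term (l i).Var → L.Term (Option (l i).Var) := fun γ =>
    .func (D.sel i) ![.var none, ((D.incl i).onTerm γ).relabel some]
  have hr : ∀ (B : Alg.{u} L) (u : Option (l i).Var → B.carrier) γ, B.eval u (r γ) =
      B.op (D.sel i)
        ![u none, B.eval (fun y => u (some y)) ((D.incl i).onTerm γ)] := by
    intro B u γ
    rw [Alg.eval_func]
    congr 1
    funext k
    fin_cases k
    · rfl
    · exact B.eval_relabel _ _ _
  have hC : ∀ γ, C.eval (fun o => o.elim w v) (r γ) = C.op (D.sel i)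
      ![w, ((D.incl i).reduct (l i).algebraic C).eval v γ] := fun γ => by
    rw [hr, Translation.eval_onTerm (l i).algebraic]
    rfl
  change C.op _ _ ∈ H
  rw [← hC]
  refine D.of_valid hH (D.emb i) (Γ := insert (.var none) (r '' Γ)) ?_ _ ?_
  · intro j A F hF u hu
    rw [hr]
    obtain rfl | hij := eq_or_ne i j
    · rw [D.op_sel]
      change (D.red i A).eval (fun y => u (some y)) ((D.incl i).onTerm φ) ∈ F
      rw [D.eval_incl]
      refine hF Γ φ hΓ _ fun γ hγ => ?_
      have := hu _ (Set.mem_insert_of_mem _ (Set.mem_image_of_mem r hγ))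
      rw [hr, D.op_sel] at this
      change (D.red i A).eval (fun y => u (some y)) ((D.incl i).onTerm γ) ∈ F at this
      rwa [D.eval_incl] at this
    · rw [D.op_sel_of_ne hij]
      exact hu _ (Set.mem_insert _ _)
  · rintro _ (rfl | ⟨γ, hγ, rfl⟩)
    · exact hw
    · rw [hC]
      exact hv γ hγ

/-- If all logics `l i` are truth-equational, then so is their combination, with the union of the
sets of defining equations.  An element that satisfies these equations lies in each of the filters of
`isFilter_sel`, and a filter is closed under the rule `{sel i (x, y) : i} ⊢ y`. -/
theorem isTruthEquational_logic (hl : ∀ i, (l i).IsTruthEquational) :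
    D.logic.IsTruthEquational := by
  have := D.infinite_var
  choose E hE using hl
  have hE' : ∀ i, (l i).DefinesTruth (E i) := hE
  refine ⟨{e | ∃ i, ∃ s t, (s, t) ∈ E i ∧ e = ((D.incl i).onTerm s, (D.incl i).onTerm t)},
    fun C H hH a => ⟨?_, fun ha => ?_⟩⟩
  · rintro ha _ ⟨i, s, t, hst, rfl⟩
    refine hH.2 _ _ fun G hG hHG => leibniz_iff.2 fun p v => ?_
    obtain ⟨e⟩ := exists_embedding (Option ℕ) V
    -- The variable `none` is assigned to `a`; the argument of the polynomial is replaced by a term.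
    let r : (l i).lang.Term Unit → L.Term (Option ℕ) := fun q =>
      p.subst fun o => o.elim (((D.incl i).onTerm q).relabel fun _ => none) fun m => .var (some m)
    have hr : ∀ (B : Alg.{u} L) (w : Option ℕ → B.carrier) q, B.eval w (r q) =
        B.eval (fun o => o.elim (B.eval (fun _ => w none) ((D.incl i).onTerm q))
          fun m => w (some m)) p := by
      intro B w q
      rw [Alg.eval_subst]
      congr 1
      funext o
      cases o
      · exact B.eval_relabel _ _ _
      · rfl
    have key : ∀ q q' : (l i).lang.Term Unit,
        (∀ (A : Alg.{u} (l i).lang) (F : Set A.carrier), (l i).IsFilter A F →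
          ∀ a ∈ F, Leibniz A F (A.eval (fun _ => a) q) (A.eval (fun _ => a) q')) →
        C.eval (fun o => o.elim (C.eval (fun _ => a) ((D.incl i).onTerm q)) v) p ∈ G →
        C.eval (fun o => o.elim (C.eval (fun _ => a) ((D.incl i).onTerm q')) v) p ∈ G := by
      intro q q' hqq' h
      have hC : ∀ q, C.eval (fun o => o.elim a v) (r q) =
          C.eval (fun o => o.elim (C.eval (fun _ => a) ((D.incl i).onTerm q)) v) p := hr C _
      rw [← hC] at h ⊢
      refine D.of_valid hG e (Γ := {.var none, r q}) ?_ _ ?_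
      · intro j A F hF w hw
        have h₁ : w none ∈ F := hw _ (Set.mem_insert _ _)
        have h₂ := hw _ (Set.mem_insert_of_mem _ rfl)
        rw [hr] at h₂ ⊢
        obtain rfl | hij := eq_or_ne i j
        · rw [D.eval_incl] at h₂ ⊢
          exact (leibniz_iff.1 ((hqq' A F hF _ h₁).reduct D.algebraic (D.τ i)) p _).1 h₂
        · rw [D.eval_incl_of_ne hij] at h₂ ⊢
          exact h₂
      · rintro _ (rfl | rfl)
        · exact hHG ha
        · exact h
    have hL : ∀ (A : Alg.{u} (l i).lang) (F : Set A.carrier), (l i).IsFilter A F →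
        ∀ a ∈ F, Leibniz A F (A.eval (fun _ => a) s) (A.eval (fun _ => a) t) :=
      fun A F hF a ha => ((hE' i).mem_iff hF a).1 ha _ hst F hF subset_rfl
    exact ⟨key s t hL, key t s fun A F hF a ha =>
      leibniz_iff.2 ((polySetoid A F).symm (leibniz_iff.1 (hL A F hF a ha)))⟩
  · obtain ⟨e⟩ := exists_embedding (Fin 2) V
    let w : C.carrier := C.op D.thm fun _ => a
    have hw : w ∈ H := D.of_valid hH.1 e (Γ := ∅) (φ := .func D.thm fun _ => .var 0)
      (fun i A F hF v _ => D.τ_thm i A F hF _) (fun _ => a) fun _ h => h.elim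
    refine D.of_valid hH.1 e (Γ := {t | ∃ i, t = .func (D.sel i) .var}) (φ := .var 1) ?_ ![w, a] ?_
    · intro i A F hF v hv
      have := hv _ ⟨i, rfl⟩
      rwa [Alg.eval_func, D.op_sel] at this
    · rintro _ ⟨i, rfl⟩
      refine ((hE' i).mem_iff (D.isFilter_sel hH.1 hw i) a).2 ?_
      rintro ⟨s, t⟩ hst G - -
      have := ha _ ⟨i, s, t, hst, rfl⟩
      simp only [Translation.eval_onTerm (l i).algebraic] at this
      rw [this]
      exact Leibniz.refl _ _ _

end Combination

/-- A theorem of a logic, as a term in one variable. -/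
theorem Logic.HasTheorems.exists_term {l : Logic.{u}} (h : l.HasTheorems) :
    ∃ φ : l.lang.Term (Fin 1), ∀ (A : Alg.{u} l.lang) F, l.IsFilter A F → ∀ v,
      A.eval v φ ∈ F := by
  obtain ⟨φ, hφ⟩ := h
  refine ⟨φ.relabel fun _ => 0, fun A F hF v => ?_⟩
  rw [Alg.eval_relabel]
  exact hF ∅ φ hφ _ fun _ h => h.elim

/-- Every family of truth-equational logics that is indexed by a type in `Type u` has a
truth-equational lower bound.  The `n`-ary symbols are the families of `n`-ary terms. -/
theorem exists_truthEquational_le {I : Type u} (l : I → Logic.{u})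
    (hl : ∀ i, (l i).IsTruthEquational) :
    ∃ m : Logic.{u}, m.IsTruthEquational ∧ ∀ i, m ≤ l i := by
  classical
  choose φ hφ using fun i => (hl i).hasTheorems.exists_term
  have hpos : ∀ i n, (l i).lang.Functions n → 0 < n := fun i n f =>
    Nat.pos_of_ne_zero fun h => (l i).no_constants.false (h ▸ f)
  let L : FirstOrder.Language.{u, 0} :=
    { Functions := fun n => {_f : ∀ i, (l i).lang.Term (Fin n) // 0 < n}
      Relations := fun _ => Empty }
  -- The family with the term `t` at the index `i` and the variable `k` elsewhere.
  let upd : ∀ (n : ℕ) (i : I), (l i).lang.Term (Fin n) → Fin n → ∀ j, (l j).lang.Term (Fin n) :=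
    fun n i t k => Function.update (β := fun j => (l j).lang.Term (Fin n)) (fun _ => .var k) i t
  have upd_self : ∀ n i t k, upd n i t k i = t := fun n i t k =>
    Function.update_self (β := fun j => (l j).lang.Term (Fin n)) i t _
  have upd_of_ne : ∀ n i t k j, i ≠ j → upd n i t k j = .var k := fun n i t k j hij =>
    Function.update_of_ne (β := fun j => (l j).lang.Term (Fin n)) hij.symm t _
  let V : Type u := ULift.{u} ℕ ⊕ Σ i, Option (l i).Var
  let D : Combination l L V :=
    { algebraic := fun _ => inferInstanceAs (IsEmpty Empty)
      no_constants := ⟨fun f => f.2.false⟩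
      infinite_var := inferInstance
      emb := fun i => (Function.Embedding.sigmaMk (β := fun i => Option (l i).Var) i).trans
        Function.Embedding.inr
      τ := fun i n f => f.1 i
      σ := fun i n f => ⟨upd n i (.func f .var) ⟨0, hpos i n f⟩, hpos i n f⟩
      sel := fun i => ⟨upd 2 i (.var 1) 0, Nat.two_pos⟩
      thm := ⟨φ, Nat.one_pos⟩
      τ_σ := fun i n f => upd_self ..
      τ_σ_of_ne := fun i j hij n f => ⟨_, upd_of_ne _ _ _ _ _ hij⟩
      τ_sel := fun i => upd_self ..
      τ_sel_of_ne := fun i j hij => upd_of_ne _ _ _ _ _ hij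
      τ_thm := hφ }
  exact ⟨D.logic, D.isTruthEquational_logic hl, D.logic_le⟩

/-! ### Truth-equationality as a Leibniz class -/

/-- The language with the set `X` of `n`-ary symbols for each positive `n`. -/
abbrev uniformLang (X : Type u) : FirstOrder.Language.{u, 0} where
  Functions n := {_x : X // 0 < n}
  Relations _ := Empty

theorem isAlgebraic_uniformLang (X : Type u) : (uniformLang X).IsAlgebraic :=
  fun _ => inferInstanceAs (IsEmpty Empty)

theorem isEmpty_uniformLang_functions (X : Type u) : IsEmpty ((uniformLang X).Functions 0) :=
  ⟨fun f => f.2.false⟩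

open Cardinal in
/-- Every truth-equational logic has a truth-equational lower bound over a language and a set of
variables determined by a sufficiently large set `X`. Over a given `X` there are only set-many
logics. -/
theorem exists_uniform_le {l : Logic.{u}} (hl : l.IsTruthEquational) (X : Type u) [Infinite X]
    (hV : #(Option l.Var) ≤ #X) (hX : ∀ n, #(l.lang.Term (Fin n)) ≤ #X) :
    ∃ c : Consequence (uniformLang X) X,
      (c.toLogic (isAlgebraic_uniformLang X) (isEmpty_uniformLang_functions X)
        inferInstance).IsTruthEquational ∧
      c.toLogic (isAlgebraic_uniformLang X) (isEmpty_uniformLang_functions X) inferInstance ≤ l := by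
  obtain ⟨φ, hφ⟩ := hl.hasTheorems.exists_term
  have hpos : ∀ n, l.lang.Functions n → 0 < n := fun n f =>
    Nat.pos_of_ne_zero fun h => l.no_constants.false (h ▸ f)
  obtain ⟨e⟩ := hV
  have hsurj : ∀ n, 0 < n → ∃ g : X → l.lang.Term (Fin n), Function.Surjective g := by
    intro n hn
    obtain ⟨i⟩ := hX n
    have : Nonempty (l.lang.Term (Fin n)) := ⟨.var ⟨0, hn⟩⟩
    exact ⟨Function.invFun i, Function.invFun_surjective i.injective⟩
  choose g hg using hsurj
  choose s hs using hg
  let D : Combination (fun _ : Unit => l) (uniformLang X) X :=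
    { algebraic := isAlgebraic_uniformLang X
      no_constants := isEmpty_uniformLang_functions X
      infinite_var := inferInstance
      emb := fun _ => e
      τ := fun _ n f => g n f.2 f.1
      σ := fun _ n f => ⟨s n (hpos n f) (.func f .var), hpos n f⟩
      sel := fun _ => ⟨s 2 Nat.two_pos (.var 1), Nat.two_pos⟩
      thm := ⟨s 1 Nat.one_pos φ, Nat.one_pos⟩
      τ_σ := fun _ n f => hs n _ _
      τ_σ_of_ne := fun i j hij => (hij rfl).elim
      τ_sel := fun _ => hs 2 _ _
      τ_sel_of_ne := fun i j hij => (hij rfl).elim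
      τ_thm := fun _ A F hF v => by
        rw [hs]
        exact hφ A F hF v }
  exact ⟨D.consequence, D.isTruthEquational_logic fun _ => hl, D.logic_le ()⟩

/-- A truth-equational lower bound of a given family of truth-equational logics and of all
truth-equational logics that are small with respect to `X`. -/
theorem exists_truthEquational_le_of_small (X : Type u) [Infinite X] {I : Type u}
    (l : I → {l : Logic.{u} // l.IsTruthEquational}) :
    ∃ m : {l : Logic.{u} // l.IsTruthEquational}, (∀ i, m.1 ≤ (l i).1) ∧
      ∀ c : Consequence (uniformLang X) X,
        (c.toLogic (isAlgebraic_uniformLang X) (isEmpty_uniformLang_functions X)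
          inferInstance).IsTruthEquational →
        m.1 ≤ c.toLogic (isAlgebraic_uniformLang X) (isEmpty_uniformLang_functions X)
          inferInstance := by
  let k : I ⊕ {c : Consequence (uniformLang X) X //
      (c.toLogic (isAlgebraic_uniformLang X) (isEmpty_uniformLang_functions X)
        inferInstance).IsTruthEquational} → Logic.{u} :=
    Sum.elim (fun i => (l i).1) fun c => c.1.toLogic (isAlgebraic_uniformLang X)
      (isEmpty_uniformLang_functions X) inferInstance
  obtain ⟨m, hm, hle⟩ := exists_truthEquational_le k (by rintro (i | c); exacts [(l i).2, c.2])
  exact ⟨⟨m, hm⟩, fun i => hle (.inl i), fun c hc => hle (.inr ⟨c, hc⟩)⟩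

open Cardinal in
theorem isLeibnizClass_truthEquational : IsLeibnizClass TruthEquational.{u} := by
  let X : Ordinal.{u} → Type u := fun α => α.ToType ⊕ ULift.{u} ℕ
  -- By recursion on `α`, choose a lower bound of the previous logics and of those of size `α`.
  let ℓ : Ordinal.{u} → {l : Logic.{u} // l.IsTruthEquational} :=
    (inferInstance : WellFoundedLT Ordinal.{u}).wf.fix fun α prev =>
      (exists_truthEquational_le_of_small (X α) (I := Shrink.{u} (Set.Iio α)) fun i =>
        prev ((equivShrink (Set.Iio α)).symm i).1 ((equivShrink (Set.Iio α)).symm i).2).choose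
  have hℓ : ∀ α, (∀ β < α, (ℓ α).1 ≤ (ℓ β).1) ∧ ∀ c : Consequence (uniformLang (X α)) (X α),
      (c.toLogic (isAlgebraic_uniformLang _) (isEmpty_uniformLang_functions _)
        inferInstance).IsTruthEquational →
      (ℓ α).1 ≤ c.toLogic (isAlgebraic_uniformLang _) (isEmpty_uniformLang_functions _)
        inferInstance := by
    intro α
    have hspec := (exists_truthEquational_le_of_small (X α) (I := Shrink.{u} (Set.Iio α)) fun i =>
      ℓ ((equivShrink (Set.Iio α)).symm i).1).choose_spec
    have heq : ℓ α = _ := WellFounded.fix_eq _ _ α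
    rw [heq]
    refine ⟨fun β hβ => ?_, hspec.2⟩
    simpa using hspec.1 (equivShrink _ ⟨β, hβ⟩)
  refine ⟨⟨fun α => (ℓ α).1, fun α β hαβ => ?_⟩, Set.ext fun l => ⟨fun hl => ?_, ?_⟩⟩
  · obtain rfl | h := hαβ.eq_or_lt
    · exact Logic.le_refl _
    · exact (hℓ β).1 α h
  · let κ : Cardinal.{u} := #(Option l.Var) + #(Σ n, l.lang.Term (Fin n))
    have hκ : κ ≤ #(X κ.ord) := by simp [X]
    obtain ⟨c, hc, hle⟩ := exists_uniform_le hl (X κ.ord) (le_self_add.trans hκ) fun n =>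
      (mk_le_of_injective (f := fun t => (⟨n, t⟩ : Σ n, l.lang.Term (Fin n)))
        fun s t h => eq_of_heq (Sigma.mk.inj h).2).trans (le_add_self.trans hκ)
    exact ⟨κ.ord, Logic.le_trans ((hℓ _).2 c hc) hle⟩
  · rintro ⟨α, hα⟩
    exact (ℓ α).2.of_le hα

end AAL

theorem theorem5p8 :
    AAL.IsMeetPrimeAmongLogicsWithTheorems AAL.TruthEquational.{u} ∧
      ∀ l₁ l₂ : AAL.Logic.{u}, l₁.HasTheorems → l₂.HasTheorems →
        ¬ l₁.IsTruthEquational → ¬ l₂.IsTruthEquational →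
          ∃ l : AAL.Logic.{u}, l₁ ≤ l ∧ l₂ ≤ l ∧ ¬ l.IsTruthEquational := by
  refine ⟨⟨AAL.isLeibnizClass_truthEquational, fun l hl => hl.hasTheorems, ?_⟩,
    fun l₁ l₂ h₁ h₂ h₁' h₂' => AAL.exists_not_isTruthEquational_ge h₁ h₂ h₁' h₂'⟩
  rintro _ _ ⟨Φ, rfl⟩ ⟨Ψ, rfl⟩ hΦ hΨ hinf
  by_contra! hcon
  obtain ⟨l₁, ⟨α, hα⟩, h₁⟩ := Set.not_subset.1 hcon.1
  obtain ⟨l₂, ⟨β, hβ⟩, h₂⟩ := Set.not_subset.1 hcon.2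
  obtain ⟨l, hl₁, hl₂, hl⟩ := AAL.exists_not_isTruthEquational_ge (hΦ ⟨α, hα⟩) (hΨ ⟨β, hβ⟩) h₁ h₂
  exact hl (hinf ⟨⟨α, AAL.Logic.le_trans hα hl₁⟩, ⟨β, AAL.Logic.le_trans hβ hl₂⟩⟩)
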